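/- Consider a two-transmitter, $K$-receiver discrete memoryless channel with finite input alphabets $\mathcal X_1,\mathcal X_2$, finite output alphabets $\mathcal Y_1,\dots,\mathcal Y_K$ and transition probabilities $p(y_1,\dots,y_K\mid x_1,x_2)$. A feedback code of block length $N$ and rates $(R_1,R_2)$, $R_1,R_2\ge 0$, has independent, uniformly distributed messages $W_m\in\{1,\dots,\lceil 2^{NR_m}\rceil\}$, $m=1,2$; encoding functions $X_{mi}=f_{mi}(W_m,Y_1^{i-1},\dots,Y_K^{i-1})$, $1\le i\le N$, where $Y_k^{i-1}=(Y_{k1},\dots,Y_{k,i-1})$; and, for each $k$, a decoding function by which receiver $k$ estimates both messages $(W_1,W_2)$ from its own outputs $Y_k^N$. Its error probability is the probability that at least one receiver does not recover $(W_1,W_2)$. A pair $(R_1,R_2)$ of non-negative rates is achievable if there are feedback codes of these rates, one for each block length $N$, whose error probabilities tend to $0$ as $N\to\infty$; the feedback capacity region is the closure of the set of achievable pairs. Let $U$ be a random variable with values in any finite set $\mathcal U$ (in particular in one with $|\mathcal U|\le\min\{|\mathcal X_1||\mathcal X_2|,|\mathcal Y_1|,\dots,|\mathcal Y_K|\}+2$),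 and let $(U,X_1,X_2,Y_1,\dots,Y_K)$ have a joint distribution of the form $p(u)\,p(x_1\mid u)\,p(x_2\mid u)\,p(y_1,\dots,y_K\mid x_1,x_2)$. Then every pair of real numbers $R_1,R_2\ge 0$ with \[ R_1\le I(X_1;Y_1,\dots,Y_K\mid X_2,U),\qquad R_2\le I(X_2;Y_1,\dots,Y_K\mid X_1,U),\qquad R_1+R_2\le I(X_1,X_2;Y_k)\ \text{ for every } k, \] where all mutual informations are in bits (logarithms to base $2$), belongs to the feedback capacity region of the channel. -/

import Mathlib

open Filter Topology

noncomputable section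

namespace FeedbackMulticast

/-! ### Random variables on a finite probability space, information in bits -/

section Information

variable {Ω α β γ : Type*} [Fintype Ω] [Fintype α] [Fintype β] [Fintype γ]

open Classical in
/-- The probability that the random variable `X` on the finite sample space `Ω` with probability
mass function `P` takes the value `a`. -/
def law (P : Ω → ℝ) (X : Ω → α) (a : α) : ℝ :=
  ∑ ω, if X ω = a then P ω else 0

/-- The mutual information `I(X; Y)`, in bits. Terms with `P(X = a, Y = b) = 0` contribute `0`. -/
def mutualInfo (P : Ω → ℝ) (X : Ω → α) (Y : Ω → β) : ℝ :=
  ∑ a, ∑ b, law P (fun ω => (X ω, Y ω)) (a, b) *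
    Real.logb 2 (law P (fun ω => (X ω, Y ω)) (a, b) / (law P X a * law P Y b))

/-- The conditional mutual information `I(X; Y | Z)`, in bits. Terms with
`P(X = a, Y = b, Z = c) = 0` contribute `0`. -/
def condMutualInfo (P : Ω → ℝ) (X : Ω → α) (Y : Ω → β) (Z : Ω → γ) : ℝ :=
  ∑ a, ∑ b, ∑ c, law P (fun ω => (X ω, Y ω, Z ω)) (a, b, c) *
    Real.logb 2 (law P (fun ω => (X ω, Y ω, Z ω)) (a, b, c) * law P Z c /
      (law P (fun ω => (X ω, Z ω)) (a, c) * law P (fun ω => (Y ω, Z ω)) (b, c)))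

end Information

/-! ### The channel -/

/-- A two-transmitter, `K`-receiver discrete memoryless channel with finite alphabets: the transition
probabilities `prob x₁ x₂ y = p(y₁, …, y_K | x₁, x₂)`. -/
structure Channel (X₁ X₂ : Type*) {K : ℕ} (Y : Fin K → Type*) [∀ k, Fintype (Y k)] where
  prob : X₁ → X₂ → (∀ k, Y k) → ℝ
  prob_mem : ∀ x₁ x₂, prob x₁ x₂ ∈ stdSimplex ℝ (∀ k, Y k)

/-- A feedback code of block length `N` with `M₁` and `M₂` messages. The `i`-th symbol of a
transmitter is a function of its own message and of the outputs of all the receivers at the times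
before `i`; receiver `k` estimates both messages from its own `N` outputs. -/
structure FeedbackCode (X₁ X₂ : Type*) {K : ℕ} (Y : Fin K → Type*) (N M₁ M₂ : ℕ) where
  enc₁ : (i : Fin N) → Fin M₁ → (Fin i → ∀ k, Y k) → X₁
  enc₂ : (i : Fin N) → Fin M₂ → (Fin i → ∀ k, Y k) → X₂
  dec : (k : Fin K) → (Fin N → Y k) → Fin M₁ × Fin M₂

/-- The first `i` entries of a sequence of length `N`. -/
def past {A : Type*} {N : ℕ} (y : Fin N → A) (i : Fin N) : Fin i → A :=
  fun t => y (Fin.castLE i.isLt.le t)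

section Coding

variable {X₁ X₂ : Type*} {K : ℕ} {Y : Fin K → Type*} [∀ k, Fintype (Y k)]

/-- The joint probability mass function `p(u) p(x₁|u) p(x₂|u) p(y₁, …, y_K | x₁, x₂)`. -/
def Channel.joint {U : Type*} (W : Channel X₁ X₂ Y) (pU : U → ℝ) (q₁ : U → X₁ → ℝ)
    (q₂ : U → X₂ → ℝ) (ω : U × X₁ × X₂ × (∀ k, Y k)) : ℝ :=
  pU ω.1 * q₁ ω.1 ω.2.1 * q₂ ω.1 ω.2.2.1 * W.prob ω.2.1 ω.2.2.1 ω.2.2.2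

/-- The probability that `N` uses of the memoryless channel produce the outputs `y`, when the
transmitters use the code `C` to send the messages `w₁` and `w₂`. -/
def Channel.outputProb (W : Channel X₁ X₂ Y) {N M₁ M₂ : ℕ} (C : FeedbackCode X₁ X₂ Y N M₁ M₂)
    (w₁ : Fin M₁) (w₂ : Fin M₂) (y : Fin N → ∀ k, Y k) : ℝ :=
  ∏ i, W.prob (C.enc₁ i w₁ (past y i)) (C.enc₂ i w₂ (past y i)) (y i)

open Classical in
/-- The average error probability: the messages are independent and uniformly distributed, and an
error occurs when at least one receiver does not recover both messages. -/
def Channel.errorProb (W : Channel X₁ X₂ Y) {N M₁ M₂ : ℕ} (C : FeedbackCode X₁ X₂ Y N M₁ M₂) : ℝ :=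
  (∑ w₁ : Fin M₁, ∑ w₂ : Fin M₂, ∑ y : Fin N → ∀ k, Y k,
    if ∃ k, C.dec k (fun i => y i k) ≠ (w₁, w₂) then W.outputProb C w₁ w₂ y else 0) /
  ((M₁ : ℝ) * (M₂ : ℝ))

/-- The number `⌈2 ^ (N R)⌉` of messages of a code of block length `N` and rate `R`. -/
def numMessages (N : ℕ) (R : ℝ) : ℕ := ⌈(2 : ℝ) ^ ((N : ℝ) * R)⌉₊

/-- A pair of non-negative rates is achievable if there are feedback codes of these rates, one for
each block length, whose average error probabilities tend to zero. -/
def Channel.Achievable (W : Channel X₁ X₂ Y) (R : ℝ × ℝ) : Prop :=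
  0 ≤ R.1 ∧ 0 ≤ R.2 ∧
    ∃ C : (N : ℕ) → FeedbackCode X₁ X₂ Y N (numMessages N R.1) (numMessages N R.2),
      Tendsto (fun N => W.errorProb (C N)) atTop (𝓝 0)

/-- The feedback capacity region: the closure of the set of achievable rate pairs. -/
def Channel.capacityRegion (W : Channel X₁ X₂ Y) : Set (ℝ × ℝ) :=
  closure {R | W.Achievable R}

end Coding

end FeedbackMulticast

end

/-!
The channel is used in `T + 1` blocks of `n` symbols, with a pair of fresh messages in each block
but the last, which carries dummy messages. In each block both transmitters know the pair of
messages of the previous block and select a cooperative codeword `u` by it; given `u`, each of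
them superposes a codeword for its own fresh message. At the end of a block, each transmitter
decodes the fresh message of the other one from the outputs that are fed back. It knows its own
input and `u`, so this works at rates below `I(X₁; Y₁, …, Y_K | X₂, U)` and `I(X₂; Y₁, …, Y_K |
X₁, U)`. A receiver treats the blocks in reverse order: it knows the fresh pair of a block from
the block after it, and decodes the pair of the previous block, which is the only unknown in the
triple of codewords of this block. Given the inputs, the output does not depend on `u`, so this
works if the sum of the rates is below `I(X₁, X₂; Y_k)`. For `T` fixed but large, the dummy
messages cost little.

The same random codebook serves for all blocks. By `sum_error_blockMarkovCode_le`, the error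
probability for given messages is at most the sum over the blocks of the probabilities that the
output of a block, when both transmitters know the previous pair, misleads somebody. Hence
independence between blocks is not needed, and it suffices to bound the expected error probability
of one block, for fixed messages, over the choice of the codebook. All decoders test whether an
information density exceeds a threshold. The true codeword fails the test with small probability
by the weak law of large numbers (`tendsto_density`), and an independent codeword passes it with
probability at most the inverse of the threshold (`expect_independent_le`). Since the bound holds
for all messages, it survives the restriction to a subset of them, and some codebook is as good as
the average.
-/

noncomputable section

namespace FeedbackMulticast

/-! ### Expectations over finite probability spaces -/

section Expectation

variable {α β ι κ : Type*} [Fintype α] [Fintype β] [Fintype ι] [Fintype κ]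
  [DecidableEq ι] [DecidableEq κ]

/-- The expectation of `f` under the probability mass function `p`. -/
def expect (p f : α → ℝ) : ℝ := ∑ a, p a * f a

/-- The product of the probability mass functions `q i`: the law of a family of independent random
variables, the `i`-th of which has law `q i`. -/
def piLaw (q : ι → α → ℝ) (f : ι → α) : ℝ := ∏ i, q i (f i)

/-- The joint law of a random variable with law `p` and of one whose conditional law given the
first is `q`. -/
def compLaw (p : α → ℝ) (q : α → β → ℝ) (x : α × β) : ℝ := p x.1 * q x.1 x.2

theorem expect_mono {p f g : α → ℝ} (hp : p ∈ stdSimplex ℝ α) (h : ∀ a, f a ≤ g a) :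
    expect p f ≤ expect p g :=
  Finset.sum_le_sum fun a _ => mul_le_mul_of_nonneg_left (h a) (hp.1 a)

theorem expect_nonneg {p f : α → ℝ} (hp : p ∈ stdSimplex ℝ α) (h : ∀ a, 0 ≤ f a) :
    0 ≤ expect p f :=
  Finset.sum_nonneg fun a _ => mul_nonneg (hp.1 a) (h a)

theorem expect_add (p f g : α → ℝ) :
    expect p (fun a => f a + g a) = expect p f + expect p g := by
  simp only [expect, mul_add, Finset.sum_add_distrib]

theorem expect_sum {σ : Type*} (s : Finset σ) (p : α → ℝ) (f : σ → α → ℝ) :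
    expect p (fun a => ∑ i ∈ s, f i a) = ∑ i ∈ s, expect p (f i) := by
  simp only [expect, Finset.mul_sum]
  exact Finset.sum_comm

theorem expect_const {p : α → ℝ} (hp : p ∈ stdSimplex ℝ α) (c : ℝ) :
    expect p (fun _ => c) = c := by
  simp only [expect, ← Finset.sum_mul, hp.2, one_mul]

theorem expect_mul_const (p f : α → ℝ) (c : ℝ) :
    expect p (fun a => f a * c) = expect p f * c := by
  simp only [expect, Finset.sum_mul, mul_assoc]

theorem expect_const_mul (p f : α → ℝ) (c : ℝ) :
    expect p (fun a => c * f a) = c * expect p f := by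
  simp only [expect, Finset.mul_sum]
  exact Finset.sum_congr rfl fun a _ => by ring

theorem expect_comm (p : α → ℝ) (q : β → ℝ) (f : α → β → ℝ) :
    expect p (fun a => expect q (f a)) = expect q (fun b => expect p fun a => f a b) := by
  simp only [expect, Finset.mul_sum]
  rw [Finset.sum_comm]
  exact Finset.sum_congr rfl fun b _ => Finset.sum_congr rfl fun a _ => by ring

theorem nonempty_of_mem_stdSimplex {p : α → ℝ} (hp : p ∈ stdSimplex ℝ α) :
    Nonempty α := by
  by_contra h
  rw [not_nonempty_iff] at h
  simpa using hp.2

theorem exists_le_expect {p : α → ℝ} (hp : p ∈ stdSimplex ℝ α) (f : α → ℝ) :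
    ∃ a, f a ≤ expect p f := by
  have := nonempty_of_mem_stdSimplex hp
  obtain ⟨a, ha⟩ := Finite.exists_min f
  exact ⟨a, (expect_const hp (f a)).symm.le.trans (expect_mono hp ha)⟩

theorem compLaw_mem {p : α → ℝ} {q : α → β → ℝ} (hp : p ∈ stdSimplex ℝ α)
    (hq : ∀ a, q a ∈ stdSimplex ℝ β) : compLaw p q ∈ stdSimplex ℝ (α × β) := by
  refine ⟨fun x => mul_nonneg (hp.1 _) ((hq _).1 _), ?_⟩
  simp only [compLaw, Fintype.sum_prod_type, ← Finset.mul_sum, (hq _).2, mul_one, hp.2]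

theorem expect_compLaw (p : α → ℝ) (q : α → β → ℝ) (f : α × β → ℝ) :
    expect (compLaw p q) f = expect p fun a => expect (q a) fun b => f (a, b) := by
  simp only [expect, compLaw, Fintype.sum_prod_type, Finset.mul_sum, mul_assoc]

theorem expect_piLaw_prod (q h : ι → α → ℝ) :
    expect (piLaw q) (fun f => ∏ i, h i (f i)) = ∏ i, expect (q i) (h i) := by
  simp only [expect, piLaw, ← Finset.prod_mul_distrib]
  rw [Finset.prod_univ_sum, Fintype.piFinset_univ]

theorem piLaw_mem {q : ι → α → ℝ} (hq : ∀ i, q i ∈ stdSimplex ℝ α) :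
    piLaw q ∈ stdSimplex ℝ (ι → α) := by
  refine ⟨fun f => Finset.prod_nonneg fun i _ => (hq i).1 _, ?_⟩
  have h := expect_piLaw_prod q (fun _ _ => 1)
  simpa [expect, (hq _).2] using h

/-- Marginalization: the coordinates picked by an injective `e` are again independent. -/
theorem expect_piLaw_comp {q : ι → α → ℝ} (hq : ∀ i, q i ∈ stdSimplex ℝ α) {e : κ → ι}
    (he : Function.Injective e) (F : (κ → α) → ℝ) :
    expect (piLaw q) (fun f => F fun j => f (e j)) = expect (piLaw fun j => q (e j)) F := by
  classical
  have key (z : κ → α) :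
      expect (piLaw q) (fun f => if (fun j => f (e j)) = z then 1 else 0) =
        piLaw (fun j => q (e j)) z := by
    have h1 : (fun f : ι → α => if (fun j => f (e j)) = z then (1 : ℝ) else 0) =
        fun f => ∏ i, if ∀ j, e j = i → f i = z j then 1 else 0 := by
      funext f
      split_ifs with h
      · subst h
        exact (Finset.prod_eq_one fun i _ => if_pos fun j hj => by subst hj; rfl).symm
      · obtain ⟨j, hj⟩ := Function.ne_iff.1 h
        exact (Finset.prod_eq_zero (Finset.mem_univ (e j)) (if_neg fun h' => hj (h' j rfl))).symm
    rw [h1, expect_piLaw_prod q fun i a => if ∀ j, e j = i → a = z j then 1 else 0, piLaw]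
    symm
    refine Fintype.prod_of_injective e he _ _ (fun i hi => ?_) fun j => ?_
    · have (a : α) : (if ∀ j, e j = i → a = z j then (1 : ℝ) else 0) = 1 :=
        if_pos fun j hj => absurd ⟨j, hj⟩ hi
      simp only [this, expect, mul_one, (hq i).2]
    · have : ∀ a : α, (∀ j', e j' = e j → a = z j') ↔ a = z j := fun a =>
        ⟨fun h => h j rfl, fun h j' hj' => by rw [he hj', h]⟩
      simp [expect, this]
  calc expect (piLaw q) (fun f => F fun j => f (e j))
      = expect (piLaw q) (fun f => ∑ z, (if (fun j => f (e j)) = z then 1 else 0) * F z) := by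
        simp
    _ = expect (piLaw fun j => q (e j)) F := by
        rw [expect_sum]
        simp only [expect_mul_const, key]
        rfl

theorem expect_piLaw_apply {q : ι → α → ℝ} (hq : ∀ i, q i ∈ stdSimplex ℝ α) (i : ι)
    (F : α → ℝ) : expect (piLaw q) (fun f => F (f i)) = expect (q i) F := by
  have h := expect_piLaw_comp hq (e := fun _ : Unit => i) (fun _ _ _ => rfl) fun g => F (g ())
  rw [h]
  simp only [expect, piLaw, Finset.univ_unique, Finset.prod_singleton]
  exact Fintype.sum_equiv (Equiv.funUnique Unit α) _ _ fun f => rfl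

theorem expect_piLaw_apply₂ {q : ι → α → ℝ} (hq : ∀ i, q i ∈ stdSimplex ℝ α) {i j : ι}
    (hij : i ≠ j) (F : α → α → ℝ) :
    expect (piLaw q) (fun f => F (f i) (f j)) =
      expect (q i) fun a => expect (q j) fun b => F a b := by
  have he : Function.Injective ![i, j] := by
    intro a b
    fin_cases a <;> fin_cases b <;> simp [hij, hij.symm]
  have h := expect_piLaw_comp hq he fun g => F (g 0) (g 1)
  simp only [Matrix.cons_val_zero, Matrix.cons_val_one] at h
  rw [h, ← expect_compLaw (q i) (fun _ => q j) fun x => F x.1 x.2]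
  simp only [expect, piLaw, compLaw, Fin.prod_univ_two]
  exact Fintype.sum_equiv (finTwoArrowEquiv α) _ _ fun f => rfl

/-- A sequence of independent pairs is a pair of sequences. -/
theorem expect_piLaw_compLaw (p : ι → α → ℝ) (q : ι → α → β → ℝ) (F : (ι → α) → (ι → β) → ℝ) :
    expect (piLaw fun i => compLaw (p i) (q i))
        (fun f => F (fun i => (f i).1) fun i => (f i).2) =
      expect (piLaw p) fun a => expect (piLaw fun i => q i (a i)) fun b => F a b := by
  rw [← expect_compLaw (piLaw p) (fun a => piLaw fun i => q i (a i)) fun x => F x.1 x.2]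
  simp only [expect, piLaw, compLaw, Finset.prod_mul_distrib]
  exact Fintype.sum_equiv (Equiv.arrowProdEquivProdArrow ι (fun _ => α) (fun _ => β)) _ _
    fun f => rfl

open Classical in
/-- The weak law of large numbers, from Chebyshev's inequality. -/
theorem expect_piLaw_sum_le {p : α → ℝ} (hp : p ∈ stdSimplex ℝ α) (g : α → ℝ) {δ : ℝ}
    (hδ : 0 < δ) {n : ℕ} (hn : 0 < n) :
    expect (piLaw fun _ : Fin n => p)
        (fun f => if ∑ i, g (f i) ≤ n * (expect p g - δ) then 1 else 0) ≤
      expect p (fun a => (g a - expect p g) ^ 2) / δ ^ 2 / n := by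
  set m := expect p g with hm
  have hn' : (0 : ℝ) < n := Nat.cast_pos.2 hn
  have hc : expect p (fun a => g a - m) = 0 := by
    have := expect_add p (fun a => g a - m) fun _ => m
    simp only [sub_add_cancel, expect_const hp] at this
    change m = _ at this
    linarith
  have hpi : ∀ _ : Fin n, p ∈ stdSimplex ℝ α := fun _ => hp
  have hvar : expect (piLaw fun _ : Fin n => p) (fun f => (∑ i, (g (f i) - m)) ^ 2) =
      n * expect p fun a => (g a - m) ^ 2 := by
    simp only [sq, Finset.sum_mul_sum, expect_sum]
    have (i : Fin n) : ∑ j, expect (piLaw fun _ : Fin n => p)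
        (fun f => (g (f i) - m) * (g (f j) - m)) = expect p fun a => (g a - m) * (g a - m) := by
      rw [Finset.sum_eq_single i, expect_piLaw_apply hpi i fun a => (g a - m) * (g a - m)]
      · intro j _ hj
        rw [expect_piLaw_apply₂ hpi hj.symm fun a b => (g a - m) * (g b - m)]
        simp only [expect_const_mul, hc, mul_zero]
        exact expect_const hp 0
      · simp
    simp only [this, Finset.sum_const, Finset.card_univ, Fintype.card_fin, nsmul_eq_mul]
  calc _ ≤ expect (piLaw fun _ : Fin n => p)
        (fun f => (∑ i, (g (f i) - m)) ^ 2 * ((n * δ) ^ 2)⁻¹) := by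
        refine expect_mono (piLaw_mem hpi) fun f => ?_
        split_ifs with h
        · rw [← div_eq_mul_inv, one_le_div (by positivity)]
          have : ∑ i, (g (f i) - m) ≤ -(n * δ) := by
            rw [Finset.sum_sub_distrib]
            simp only [Finset.sum_const, Finset.card_univ, Fintype.card_fin, nsmul_eq_mul]
            linarith
          have h0 : 0 < n * δ := by positivity
          nlinarith
        · positivity
    _ = _ := by
        rw [expect_mul_const, hvar]
        field_simp

end Expectation

/-! ### Random codes for one block -/

section RandomCoding

open Classical in
theorem expect_law {Ω α : Type*} [Fintype Ω] [Fintype α] (P : Ω → ℝ) (X : Ω → α) (G : α → ℝ) :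
    expect (law P X) G = expect P fun ω => G (X ω) := by
  simp only [expect, law, Finset.sum_mul]
  rw [Finset.sum_comm]
  simp

theorem law_mem {Ω α : Type*} [Fintype Ω] [Fintype α] {P : Ω → ℝ} (hP : P ∈ stdSimplex ℝ Ω)
    (X : Ω → α) : law P X ∈ stdSimplex ℝ α := by
  classical
  refine ⟨fun a => Finset.sum_nonneg fun ω _ => ?_, ?_⟩
  · split_ifs
    exacts [hP.1 ω, le_rfl]
  · have h := (expect_law P X fun _ => 1).trans (expect_const hP 1)
    simpa [expect] using h

open Classical in
/-- Change of measure: an input `x'` drawn independently of the output `z` passes the test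
`γ * p(z) < p(z | x')` with probability at most `1 / γ`. -/
theorem expect_independent_le {χ ζ : Type*} [Fintype χ] [Fintype ζ] {q : χ → ℝ} {κ : χ → ζ → ℝ}
    (hq : q ∈ stdSimplex ℝ χ) (hκ : ∀ x, κ x ∈ stdSimplex ℝ ζ) {γ : ℝ} (hγ : 0 < γ) :
    (expect q fun x => expect (κ x) fun z => expect q fun x' =>
      if γ * (expect q fun y => κ y z) < κ x' z then 1 else 0) ≤ 1 / γ := by
  have h1 : (expect q fun x => expect (κ x) fun z => expect q fun x' =>
      if γ * (expect q fun y => κ y z) < κ x' z then 1 else 0) =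
      expect q fun x' => ∑ z, (expect q fun y => κ y z) *
        if γ * (expect q fun y => κ y z) < κ x' z then 1 else 0 := by
    rw [expect_sum]
    conv_lhs =>
      enter [2, x]
      rw [expect]
    rw [expect_sum]
    simp only [expect_mul_const, expect_const_mul]
  rw [h1]
  calc _ ≤ expect q fun x' => ∑ z, κ x' z * (1 / γ) := by
        refine expect_mono hq fun x' => Finset.sum_le_sum fun z _ => ?_
        split_ifs with h
        · rw [mul_one, mul_one_div, le_div_iff₀ hγ, mul_comm]
          exact h.le
        · rw [mul_zero]
          exact mul_nonneg ((hκ x').1 z) (by positivity)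
    _ = 1 / γ := by
        simp only [← Finset.sum_mul, (hκ _).2, one_mul]
        exact expect_const hq _

open Classical in
/-- A choice among the candidates that pass a test errs only if the true value fails the test or
some other candidate passes it. -/
theorem indicator_epsilon_le {M : Type*} [Fintype M] [Nonempty M] (S : M → Prop) (m : M)
    {_ : Decidable (Classical.epsilon S ≠ m)} :
    (if Classical.epsilon S ≠ m then (1 : ℝ) else 0) ≤
      (if S m then 0 else 1) + ∑ m' ∈ Finset.univ.erase m, if S m' then 1 else 0 := by
  have h0 : ∀ m' ∈ Finset.univ.erase m, (0 : ℝ) ≤ if S m' then 1 else 0 := fun m' _ => by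
    split_ifs <;> norm_num
  have h1 := Finset.sum_nonneg h0
  by_cases hS : S m
  · rw [if_pos hS, zero_add]
    split_ifs with h
    · have hε : S (Classical.epsilon S) := Classical.epsilon_spec ⟨m, hS⟩
      have := Finset.single_le_sum h0 (Finset.mem_erase.2 ⟨h, Finset.mem_univ _⟩)
      rwa [if_pos hε] at this
    · exact h1
  · rw [if_neg hS]
    split_ifs <;> linarith

/-- A code for one block of a block Markov scheme. The inputs depend on the pair of messages of the
previous block, which both transmitters know, and on a fresh message each. From the fed back output,
each transmitter estimates the fresh message of the other one. Receiver `k` knows the fresh pair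
and estimates the pair of the previous block: it treats the blocks in reverse order. -/
structure BlockCode {κ : Type*} (A B Z : Type*) (V : κ → Type*) (M₁ M₂ : Type*) where
  enc₁ : M₁ × M₂ → M₁ → A
  enc₂ : M₁ × M₂ → M₂ → B
  dec₁ : M₁ × M₂ → M₂ → Z → M₁
  dec₂ : M₁ × M₂ → M₁ → Z → M₂
  dec : (k : κ) → M₁ × M₂ → V k → M₁ × M₂

variable {κ U A B Z M₁ M₂ : Type*} {V : κ → Type*}

/-- The output `z` of a block with previous pair `p` and fresh pair `w` misleads a transmitter or
a receiver. -/
def BlockCode.Bad (C : BlockCode A B Z V M₁ M₂) (π : ∀ k, Z → V k) (p w : M₁ × M₂) (z : Z) : Prop :=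
  C.dec₂ p w.1 z ≠ w.2 ∨ C.dec₁ p w.2 z ≠ w.1 ∨ ∃ k, C.dec k w (π k z) ≠ p

variable [Fintype κ]

open Classical in
theorem indicator_bad_le (C : BlockCode A B Z V M₁ M₂) (π : ∀ k, Z → V k) (p w : M₁ × M₂) (z : Z) :
    (if C.Bad π p w z then (1 : ℝ) else 0) ≤ (if C.dec₂ p w.1 z ≠ w.2 then 1 else 0) +
      (if C.dec₁ p w.2 z ≠ w.1 then 1 else 0) + ∑ k, if C.dec k w (π k z) ≠ p then 1 else 0 := by
  have h0 : ∀ k ∈ Finset.univ, (0 : ℝ) ≤ if C.dec k w (π k z) ≠ p then 1 else 0 := fun k _ => by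
    split_ifs <;> norm_num
  have h1 := Finset.sum_nonneg h0
  have h2 : (0 : ℝ) ≤ if C.dec₂ p w.1 z ≠ w.2 then 1 else 0 := by split_ifs <;> norm_num
  have h3 : (0 : ℝ) ≤ if C.dec₁ p w.2 z ≠ w.1 then 1 else 0 := by split_ifs <;> norm_num
  by_cases h : C.Bad π p w z
  · rw [if_pos h]
    rcases h with h | h | ⟨k, h⟩
    · rw [if_pos h]; linarith
    · rw [if_pos h]; linarith
    · have := Finset.single_le_sum h0 (Finset.mem_univ k)
      rw [if_pos h] at this
      linarith
  · rw [if_neg h]; linarith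

variable [Fintype U] [Fintype A] [Fintype B] [Fintype Z] [∀ k, Fintype (V k)]

open Classical in
/-- The probability that the output of a block is bad. -/
def BlockCode.error (W : A → B → Z → ℝ) (π : ∀ k, Z → V k) (C : BlockCode A B Z V M₁ M₂)
    (p w : M₁ × M₂) : ℝ :=
  expect (W (C.enc₁ p w.1) (C.enc₂ p w.2)) fun z => if C.Bad π p w z then 1 else 0

/-- The probability of the output `v` of receiver `k`. -/
def receiverLaw (W : A → B → Z → ℝ) (π : ∀ k, Z → V k) (pU : U → ℝ) (q₁ : U → A → ℝ)
    (q₂ : U → B → ℝ) (k : κ) (v : V k) : ℝ :=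
  expect pU fun u => expect (q₁ u) fun a => expect (q₂ u) fun b => law (W a b) (π k) v

/-- A codebook assigns to each pair of messages of the previous block a cooperative codeword, and
the codewords of both transmitters for each fresh message. -/
abbrev Codebook (U A B M₁ M₂ : Type*) := M₁ × M₂ → U × (M₁ → A) × (M₂ → B)

/-- The block code of a codebook, with threshold decoding of the information densities. -/
def thresholdCode [Nonempty M₁] [Nonempty M₂] (W : A → B → Z → ℝ) (π : ∀ k, Z → V k) (pU : U → ℝ)
    (q₁ : U → A → ℝ) (q₂ : U → B → ℝ) (γ₁ γ₂ : ℝ) (γ : κ → ℝ) (c : Codebook U A B M₁ M₂) :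
    BlockCode A B Z V M₁ M₂ where
  enc₁ p := (c p).2.1
  enc₂ p := (c p).2.2
  dec₁ p w₂ z := Classical.epsilon fun w₁ =>
    γ₁ * (expect (q₁ (c p).1) fun a => W a ((c p).2.2 w₂) z) < W ((c p).2.1 w₁) ((c p).2.2 w₂) z
  dec₂ p w₁ z := Classical.epsilon fun w₂ =>
    γ₂ * (expect (q₂ (c p).1) fun b => W ((c p).2.1 w₁) b z) < W ((c p).2.1 w₁) ((c p).2.2 w₂) z
  dec k w v := Classical.epsilon fun p =>
    γ k * receiverLaw W π pU q₁ q₂ k v < law (W ((c p).2.1 w.1) ((c p).2.2 w.2)) (π k) v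

variable [Fintype M₁] [Fintype M₂] [DecidableEq M₁] [DecidableEq M₂]

/-- The law of the codewords that belong to one pair of messages of the previous block. -/
def entryLaw (M₁ M₂ : Type*) [Fintype M₁] [Fintype M₂] (pU : U → ℝ) (q₁ : U → A → ℝ)
    (q₂ : U → B → ℝ) : U × (M₁ → A) × (M₂ → B) → ℝ :=
  compLaw pU fun u => compLaw (piLaw fun _ => q₁ u) fun _ => piLaw fun _ => q₂ u

/-- The law of the random codebook: the codewords for different pairs of messages of the previous
block are independent, and the codewords of the transmitters are conditionally independent given
the cooperative codeword. -/
def codebookLaw (M₁ M₂ : Type*) [Fintype M₁] [Fintype M₂] (pU : U → ℝ) (q₁ : U → A → ℝ)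
    (q₂ : U → B → ℝ) : Codebook U A B M₁ M₂ → ℝ :=
  piLaw fun _ => entryLaw M₁ M₂ pU q₁ q₂

variable {pU : U → ℝ} {q₁ : U → A → ℝ} {q₂ : U → B → ℝ}

theorem entryLaw_mem (hU : pU ∈ stdSimplex ℝ U) (hq₁ : ∀ u, q₁ u ∈ stdSimplex ℝ A)
    (hq₂ : ∀ u, q₂ u ∈ stdSimplex ℝ B) :
    entryLaw M₁ M₂ pU q₁ q₂ ∈ stdSimplex ℝ (U × (M₁ → A) × (M₂ → B)) :=
  compLaw_mem hU fun u => compLaw_mem (piLaw_mem fun _ => hq₁ u) fun _ => piLaw_mem fun _ => hq₂ u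

theorem codebookLaw_mem (hU : pU ∈ stdSimplex ℝ U) (hq₁ : ∀ u, q₁ u ∈ stdSimplex ℝ A)
    (hq₂ : ∀ u, q₂ u ∈ stdSimplex ℝ B) :
    codebookLaw M₁ M₂ pU q₁ q₂ ∈ stdSimplex ℝ (Codebook U A B M₁ M₂) :=
  piLaw_mem fun _ => entryLaw_mem hU hq₁ hq₂

theorem expect_entryLaw (hq₁ : ∀ u, q₁ u ∈ stdSimplex ℝ A) (hq₂ : ∀ u, q₂ u ∈ stdSimplex ℝ B)
    (w₁ : M₁) (w₂ : M₂) (F : U → A → B → ℝ) :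
    expect (entryLaw M₁ M₂ pU q₁ q₂) (fun x => F x.1 (x.2.1 w₁) (x.2.2 w₂)) =
      expect pU fun u => expect (q₁ u) fun a => expect (q₂ u) fun b => F u a b := by
  rw [entryLaw, expect_compLaw]
  congr 1; funext u
  rw [expect_compLaw, ← expect_piLaw_apply (fun _ => hq₁ u) w₁]
  congr 1; funext f
  exact expect_piLaw_apply (fun _ => hq₂ u) w₂ fun b => F u (f w₁) b

theorem expect_codebookLaw (hU : pU ∈ stdSimplex ℝ U) (hq₁ : ∀ u, q₁ u ∈ stdSimplex ℝ A)
    (hq₂ : ∀ u, q₂ u ∈ stdSimplex ℝ B) (p : M₁ × M₂) (w₁ : M₁) (w₂ : M₂) (F : U → A → B → ℝ) :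
    expect (codebookLaw M₁ M₂ pU q₁ q₂) (fun c => F (c p).1 ((c p).2.1 w₁) ((c p).2.2 w₂)) =
      expect pU fun u => expect (q₁ u) fun a => expect (q₂ u) fun b => F u a b := by
  rw [← expect_entryLaw hq₁ hq₂ w₁ w₂ F]
  exact expect_piLaw_apply (fun _ => entryLaw_mem hU hq₁ hq₂) p
    fun x => F x.1 (x.2.1 w₁) (x.2.2 w₂)

/-- The codewords of transmitter 1 for two fresh messages are conditionally independent, given the
cooperative codeword and the codeword of transmitter 2. -/
theorem expect_codebookLaw_fresh₁ (hU : pU ∈ stdSimplex ℝ U) (hq₁ : ∀ u, q₁ u ∈ stdSimplex ℝ A)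
    (hq₂ : ∀ u, q₂ u ∈ stdSimplex ℝ B) (p : M₁ × M₂) {w₁ w₁' : M₁} (hw : w₁ ≠ w₁') (w₂ : M₂)
    (F : U → B → A → A → ℝ) :
    expect (codebookLaw M₁ M₂ pU q₁ q₂)
        (fun c => F (c p).1 ((c p).2.2 w₂) ((c p).2.1 w₁) ((c p).2.1 w₁')) =
      expect pU fun u => expect (q₂ u) fun b => expect (q₁ u) fun a => expect (q₁ u) fun a' =>
        F u b a a' := by
  rw [codebookLaw, expect_piLaw_apply (fun _ => entryLaw_mem hU hq₁ hq₂) p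
    fun x => F x.1 (x.2.2 w₂) (x.2.1 w₁) (x.2.1 w₁'), entryLaw, expect_compLaw]
  congr 1; funext u
  rw [expect_compLaw, expect_comm, ← expect_piLaw_apply (fun _ => hq₂ u) w₂]
  congr 1; funext f
  exact expect_piLaw_apply₂ (fun _ => hq₁ u) hw fun a a' => F u (f w₂) a a'

/-- The codewords of transmitter 2 for two fresh messages are conditionally independent, given the
cooperative codeword and the codeword of transmitter 1. -/
theorem expect_codebookLaw_fresh₂ (hU : pU ∈ stdSimplex ℝ U) (hq₁ : ∀ u, q₁ u ∈ stdSimplex ℝ A)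
    (hq₂ : ∀ u, q₂ u ∈ stdSimplex ℝ B) (p : M₁ × M₂) (w₁ : M₁) {w₂ w₂' : M₂} (hw : w₂ ≠ w₂')
    (F : U → A → B → B → ℝ) :
    expect (codebookLaw M₁ M₂ pU q₁ q₂)
        (fun c => F (c p).1 ((c p).2.1 w₁) ((c p).2.2 w₂) ((c p).2.2 w₂')) =
      expect pU fun u => expect (q₁ u) fun a => expect (q₂ u) fun b => expect (q₂ u) fun b' =>
        F u a b b' := by
  rw [codebookLaw, expect_piLaw_apply (fun _ => entryLaw_mem hU hq₁ hq₂) p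
    fun x => F x.1 (x.2.1 w₁) (x.2.2 w₂) (x.2.2 w₂'), entryLaw, expect_compLaw]
  congr 1; funext u
  rw [expect_compLaw, ← expect_piLaw_apply (fun _ => hq₁ u) w₁]
  congr 1; funext f
  exact expect_piLaw_apply₂ (fun _ => hq₂ u) hw fun b b' => F u (f w₁) b b'

/-- The triples of codewords for different pairs of messages of the previous block are
independent. -/
theorem expect_codebookLaw_previous (hU : pU ∈ stdSimplex ℝ U)
    (hq₁ : ∀ u, q₁ u ∈ stdSimplex ℝ A) (hq₂ : ∀ u, q₂ u ∈ stdSimplex ℝ B) {p p' : M₁ × M₂}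
    (hp : p ≠ p') (w₁ : M₁) (w₂ : M₂) (F : U × A × B → U × A × B → ℝ) :
    expect (codebookLaw M₁ M₂ pU q₁ q₂)
        (fun c => F ((c p).1, (c p).2.1 w₁, (c p).2.2 w₂)
          ((c p').1, (c p').2.1 w₁, (c p').2.2 w₂)) =
      expect (compLaw pU fun u => compLaw (q₁ u) fun _ => q₂ u) fun x =>
        expect (compLaw pU fun u => compLaw (q₁ u) fun _ => q₂ u) fun x' => F x x' := by
  rw [codebookLaw, expect_piLaw_apply₂ (fun _ => entryLaw_mem hU hq₁ hq₂) hp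
    fun x x' => F (x.1, x.2.1 w₁, x.2.2 w₂) (x'.1, x'.2.1 w₁, x'.2.2 w₂)]
  simp only [expect_compLaw]
  rw [← expect_entryLaw hq₁ hq₂ w₁ w₂]
  congr 1; funext x
  exact expect_entryLaw hq₁ hq₂ w₁ w₂ fun u a b => F _ (u, a, b)

open Classical in
/-- The bound on the error probability of a random block code, in terms of the probabilities that
the information densities stay below the thresholds. -/
def randomCodingBound (M₁ M₂ : Type*) [Fintype M₁] [Fintype M₂] (W : A → B → Z → ℝ)
    (π : ∀ k, Z → V k) (pU : U → ℝ) (q₁ : U → A → ℝ) (q₂ : U → B → ℝ) (γ₁ γ₂ : ℝ) (γ : κ → ℝ) : ℝ :=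
  ((expect pU fun u => expect (q₁ u) fun a => expect (q₂ u) fun b => expect (W a b) fun z =>
      if γ₂ * (expect (q₂ u) fun b' => W a b' z) < W a b z then 0 else 1) +
    ((Fintype.card M₂ : ℝ) - 1) * (1 / γ₂)) +
  ((expect pU fun u => expect (q₁ u) fun a => expect (q₂ u) fun b => expect (W a b) fun z =>
      if γ₁ * (expect (q₁ u) fun a' => W a' b z) < W a b z then 0 else 1) +
    ((Fintype.card M₁ : ℝ) - 1) * (1 / γ₁)) +
  ∑ k, ((expect pU fun u => expect (q₁ u) fun a => expect (q₂ u) fun b => expect (W a b) fun z =>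
      if γ k * receiverLaw W π pU q₁ q₂ k (π k z) < law (W a b) (π k) (π k z) then 0 else 1) +
    ((Fintype.card (M₁ × M₂) : ℝ) - 1) * (1 / γ k))

open Classical in
theorem sum_erase_le {M : Type*} [Fintype M] (m : M) (f : M → ℝ) {ε : ℝ}
    (h : ∀ m', m ≠ m' → f m' ≤ ε) :
    ∑ m' ∈ Finset.univ.erase m, f m' ≤ ((Fintype.card M : ℝ) - 1) * ε := by
  refine (Finset.sum_le_card_nsmul _ _ ε fun m' hm' =>
    h m' (Finset.ne_of_mem_erase hm').symm).trans_eq ?_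
  rw [Finset.card_erase_of_mem (Finset.mem_univ m), Finset.card_univ, nsmul_eq_mul,
    Nat.cast_sub (Fintype.card_pos_iff.2 ⟨m⟩), Nat.cast_one]

/-- Random coding: whatever the messages are, the expected error probability of the random block
code is small. -/
theorem expect_codebookLaw_error_le [Nonempty M₁] [Nonempty M₂] {W : A → B → Z → ℝ}
    (hW : ∀ a b, W a b ∈ stdSimplex ℝ Z) (π : ∀ k, Z → V k) (hU : pU ∈ stdSimplex ℝ U)
    (hq₁ : ∀ u, q₁ u ∈ stdSimplex ℝ A) (hq₂ : ∀ u, q₂ u ∈ stdSimplex ℝ B) {γ₁ γ₂ : ℝ} {γ : κ → ℝ}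
    (hγ₁ : 0 < γ₁) (hγ₂ : 0 < γ₂) (hγ : ∀ k, 0 < γ k) (p w : M₁ × M₂) :
    expect (codebookLaw M₁ M₂ pU q₁ q₂)
        (fun c => (thresholdCode W π pU q₁ q₂ γ₁ γ₂ γ c).error W π p w) ≤
      randomCodingBound M₁ M₂ W π pU q₁ q₂ γ₁ γ₂ γ := by
  classical
  have hc := codebookLaw_mem (M₁ := M₁) (M₂ := M₂) hU hq₁ hq₂
  have hbound (c : Codebook U A B M₁ M₂) := expect_mono (hW ((c p).2.1 w.1) ((c p).2.2 w.2))
    fun z => (indicator_bad_le (thresholdCode W π pU q₁ q₂ γ₁ γ₂ γ c) π p w z).trans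
      (add_le_add (add_le_add (indicator_epsilon_le _ w.2) (indicator_epsilon_le _ w.1))
        (Finset.sum_le_sum fun k _ => indicator_epsilon_le _ p))
  refine (expect_mono hc hbound).trans ?_
  simp only [expect_add, expect_sum]
  unfold randomCodingBound
  refine add_le_add (add_le_add (add_le_add ?_ ?_) (add_le_add ?_ ?_))
    (Finset.sum_le_sum fun k _ => add_le_add ?_ ?_)
  · exact (expect_codebookLaw hU hq₁ hq₂ p w.1 w.2 fun u a b => expect (W a b) fun z =>
      if γ₂ * (expect (q₂ u) fun b' => W a b' z) < W a b z then 0 else 1).le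
  · refine sum_erase_le _ _ fun w₂' hw => ?_
    refine (expect_codebookLaw_fresh₂ hU hq₁ hq₂ p w.1 hw fun u a b b' => expect (W a b) fun z =>
      if γ₂ * (expect (q₂ u) fun b' => W a b' z) < W a b' z then 1 else 0).trans_le ?_
    refine (expect_mono hU fun u => (expect_mono (hq₁ u) fun a => ?_).trans
      (expect_const (hq₁ u) (1 / γ₂)).le).trans (expect_const hU _).le
    simp only [expect_comm (q₂ u) (W _ _)]
    exact expect_independent_le (hq₂ u) (fun b => hW a b) hγ₂
  · exact (expect_codebookLaw hU hq₁ hq₂ p w.1 w.2 fun u a b => expect (W a b) fun z =>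
      if γ₁ * (expect (q₁ u) fun a' => W a' b z) < W a b z then 0 else 1).le
  · refine sum_erase_le _ _ fun w₁' hw => ?_
    refine (expect_codebookLaw_fresh₁ hU hq₁ hq₂ p hw w.2 fun u b a a' => expect (W a b) fun z =>
      if γ₁ * (expect (q₁ u) fun a' => W a' b z) < W a' b z then 1 else 0).trans_le ?_
    refine (expect_mono hU fun u => (expect_mono (hq₂ u) fun b => ?_).trans
      (expect_const (hq₂ u) (1 / γ₁)).le).trans (expect_const hU _).le
    simp only [expect_comm (q₁ u) (W _ _)]
    exact expect_independent_le (κ := fun a => W a b) (hq₁ u) (fun a => hW a b) hγ₁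
  · exact (expect_codebookLaw hU hq₁ hq₂ p w.1 w.2 fun u a b => expect (W a b) fun z =>
      if γ k * receiverLaw W π pU q₁ q₂ k (π k z) < law (W a b) (π k) (π k z) then 0 else 1).le
  · refine sum_erase_le _ _ fun p' hp => ?_
    refine (expect_codebookLaw_previous hU hq₁ hq₂ hp w.1 w.2 fun x x' =>
      expect (W x.2.1 x.2.2) fun z => if γ k * receiverLaw W π pU q₁ q₂ k (π k z) <
        law (W x'.2.1 x'.2.2) (π k) (π k z) then 1 else 0).trans_le ?_
    have h := expect_independent_le (κ := fun x : U × A × B => law (W x.2.1 x.2.2) (π k))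
      (compLaw_mem hU fun u => compLaw_mem (hq₁ u) fun _ => hq₂ u)
      (fun x => law_mem (hW x.2.1 x.2.2) (π k)) (hγ k)
    refine le_trans (le_of_eq ?_) h
    congr 1; funext x
    rw [expect_comm, expect_law]
    simp only [receiverLaw, expect_compLaw]
    congr!

end RandomCoding

/-! ### Block Markov codes with backward decoding -/

section BlockMarkov

/-- The entries `t * n, …, t * n + n - 1` of a sequence, with the value `z₀` beyond its end. -/
def blockOf {Z : Type*} (n : ℕ) (z₀ : Z) {i : ℕ} (h : Fin i → Z) (t : ℕ) (j : Fin n) : Z :=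
  if hj : t * n + j < i then h ⟨t * n + j, hj⟩ else z₀

theorem blockOf_past {Z : Type*} {n N : ℕ} (z₀ : Z) (y : Fin N → Z) (i : Fin N) {t : ℕ}
    (ht : t < i / n) : blockOf n z₀ (past y i) t = blockOf n z₀ y t := by
  funext j
  have h1 : t * n + j < i := by
    have := Nat.mul_le_mul_right n (Nat.succ_le_of_lt ht)
    have := Nat.div_mul_le_self i n
    have := j.2
    simp only [Nat.succ_eq_add_one, add_mul, one_mul] at *
    omega
  have h2 : t * n + j < N := h1.trans i.2
  simp only [blockOf, h1, h2, dif_pos]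
  rfl

/-- The message of the block before block `t`, with a dummy message `d` before the first block. -/
def previous {M : Type*} (d : M) (v : ℕ → M) : ℕ → M
  | 0 => d
  | t + 1 => v t

section Estimates

variable {κ A B Z M₁ M₂ : Type*} {V : κ → Type*} (D : BlockCode A B Z V M₁ M₂) (d : M₁ × M₂)

/-- The estimate by transmitter 1 of the message of transmitter 2 in the block before block `t`. -/
def forward₁ (v₁ : ℕ → M₁) (s : ℕ → Z) : ℕ → M₂
  | 0 => d.2
  | t + 1 => D.dec₂ (previous d.1 v₁ t, forward₁ v₁ s t) (v₁ t) (s t)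

/-- The estimate by transmitter 2 of the message of transmitter 1 in the block before block `t`. -/
def forward₂ (v₂ : ℕ → M₂) (s : ℕ → Z) : ℕ → M₁
  | 0 => d.1
  | t + 1 => D.dec₁ (forward₂ v₂ s t, previous d.2 v₂ t) (v₂ t) (s t)

/-- The estimate by receiver `k` of the pair of messages of block `T - j`. -/
def backward (T : ℕ) (k : κ) (s : ℕ → V k) : ℕ → M₁ × M₂
  | 0 => d
  | j + 1 => D.dec k (backward T k s j) (s (T - j))

theorem forward₁_congr (v₁ : ℕ → M₁) {s s' : ℕ → Z} {t : ℕ} (h : ∀ r < t, s r = s' r) :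
    forward₁ D d v₁ s t = forward₁ D d v₁ s' t := by
  induction t with
  | zero => rfl
  | succ t ih =>
    rw [forward₁, forward₁, ih fun r hr => h r (hr.trans t.lt_succ_self), h t t.lt_succ_self]

theorem forward₂_congr (v₂ : ℕ → M₂) {s s' : ℕ → Z} {t : ℕ} (h : ∀ r < t, s r = s' r) :
    forward₂ D d v₂ s t = forward₂ D d v₂ s' t := by
  induction t with
  | zero => rfl
  | succ t ih =>
    rw [forward₂, forward₂, ih fun r hr => h r (hr.trans t.lt_succ_self), h t t.lt_succ_self]

variable {π : ∀ k, Z → V k} {v₁ : ℕ → M₁} {v₂ : ℕ → M₂} {s : ℕ → Z} {T : ℕ}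

theorem forward₁_eq
    (h : ∀ t ≤ T, ¬ D.Bad π (previous d.1 v₁ t, previous d.2 v₂ t) (v₁ t, v₂ t) (s t))
    {t : ℕ} (ht : t ≤ T) : forward₁ D d v₁ s t = previous d.2 v₂ t := by
  induction t with
  | zero => rfl
  | succ t ih =>
    have := h t (by omega)
    simp only [BlockCode.Bad, not_or, not_not] at this
    rw [forward₁, ih (by omega), this.1]
    rfl

theorem forward₂_eq
    (h : ∀ t ≤ T, ¬ D.Bad π (previous d.1 v₁ t, previous d.2 v₂ t) (v₁ t, v₂ t) (s t))
    {t : ℕ} (ht : t ≤ T) : forward₂ D d v₂ s t = previous d.1 v₁ t := by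
  induction t with
  | zero => rfl
  | succ t ih =>
    have := h t (by omega)
    simp only [BlockCode.Bad, not_or, not_not] at this
    rw [forward₂, ih (by omega), this.2.1]
    rfl

theorem backward_eq
    (h : ∀ t ≤ T, ¬ D.Bad π (previous d.1 v₁ t, previous d.2 v₂ t) (v₁ t, v₂ t) (s t))
    (hT : (v₁ T, v₂ T) = d) (k : κ) {j : ℕ} (hj : j ≤ T) :
    backward D d T k (fun t => π k (s t)) j = (v₁ (T - j), v₂ (T - j)) := by
  induction j with
  | zero => exact hT.symm
  | succ j ih =>
    have := h (T - j) (by omega)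
    simp only [BlockCode.Bad, not_or, not_not, not_exists] at this
    rw [backward, ih (by omega), this.2.2 k]
    obtain ⟨r, hr⟩ : ∃ r, T - j = r + 1 := ⟨T - j - 1, by omega⟩
    rw [hr, show T - (j + 1) = r by omega]
    rfl

end Estimates

variable {X₁ X₂ : Type*} {K : ℕ} {Y : Fin K → Type*}

/-- The block Markov feedback code with `T + 1` blocks of length `n`. The messages are split into
sequences by `φ₁` and `φ₂`. The channel uses after the last block carry the constant inputs `x₁`
and `x₂`. -/
def blockMarkovCode {M₁ M₂ : Type*} {n : ℕ} (hn : 0 < n) (N T : ℕ)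
    (D : BlockCode (Fin n → X₁) (Fin n → X₂) (Fin n → ∀ k, Y k) (fun k => Fin n → Y k) M₁ M₂)
    (d : M₁ × M₂) (x₁ : X₁) (x₂ : X₂) (z₀ : ∀ k, Y k) {m₁ m₂ : ℕ} [NeZero m₁] [NeZero m₂]
    (φ₁ : Fin m₁ → ℕ → M₁) (φ₂ : Fin m₂ → ℕ → M₂) : FeedbackCode X₁ X₂ Y N m₁ m₂ where
  enc₁ i w h :=
    if i / n ≤ T then
      D.enc₁ (previous d.1 (φ₁ w) (i / n), forward₁ D d (φ₁ w) (blockOf n z₀ h) (i / n))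
        (φ₁ w (i / n)) ⟨i % n, Nat.mod_lt _ hn⟩
    else x₁
  enc₂ i w h :=
    if i / n ≤ T then
      D.enc₂ (forward₂ D d (φ₂ w) (blockOf n z₀ h) (i / n), previous d.2 (φ₂ w) (i / n))
        (φ₂ w (i / n)) ⟨i % n, Nat.mod_lt _ hn⟩
    else x₂
  dec k y :=
    (Function.invFun φ₁ fun t => (backward D d T k (blockOf n (z₀ k) y) (T - t)).1,
      Function.invFun φ₂ fun t => (backward D d T k (blockOf n (z₀ k) y) (T - t)).2)

/-- Outputs that are produced one after the other, each from the previous ones, have total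
probability one. -/
theorem sum_prod_past {Z : Type*} [Fintype Z] {N : ℕ} (κ : (i : Fin N) → (Fin i → Z) → Z → ℝ)
    (hκ : ∀ i h, ∑ z, κ i h z = 1) : ∑ y : Fin N → Z, ∏ i, κ i (past y i) (y i) = 1 := by
  induction N with
  | zero => simp
  | succ N ih =>
    rw [← (Fin.snocEquiv fun _ : Fin (N + 1) => Z).sum_comp, Fintype.sum_prod_type, Finset.sum_comm]
    have h0 (z : Z) (y : Fin N → Z) (i : Fin N) :
        (Fin.snocEquiv fun _ : Fin (N + 1) => Z) (z, y) i.castSucc = y i :=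
      Fin.snoc_castSucc (α := fun _ => Z) z y i
    have h0' (z : Z) (y : Fin N → Z) :
        (Fin.snocEquiv fun _ : Fin (N + 1) => Z) (z, y) (Fin.last N) = z :=
      Fin.snoc_last (α := fun _ => Z) z y
    have h1 (z : Z) (y : Fin N → Z) (i : Fin N) :
        past ((Fin.snocEquiv fun _ : Fin (N + 1) => Z) (z, y)) i.castSucc = past y i :=
      funext fun t => h0 z y (Fin.castLE i.isLt.le t)
    have h2 (z : Z) (y : Fin N → Z) :
        past ((Fin.snocEquiv fun _ : Fin (N + 1) => Z) (z, y)) (Fin.last N) = y :=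
      funext fun t => h0 z y t
    have h3 (y : Fin N → Z) : ∑ z, κ (Fin.last N) y z = 1 := hκ (Fin.last N) y
    simp only [Fin.prod_univ_castSucc, h0, h0', h1, h2, ← Finset.mul_sum, h3, mul_one]
    exact ih (fun i => κ i.castSucc) fun i => hκ i.castSucc

variable [∀ k, Fintype (Y k)]

/-- The channel that transmits blocks of `n` symbols. -/
def Channel.block (W : Channel X₁ X₂ Y) (n : ℕ) (a : Fin n → X₁) (b : Fin n → X₂) :
    (Fin n → ∀ k, Y k) → ℝ :=
  piLaw fun j => W.prob (a j) (b j)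

open Classical in
/-- If no block is bad, the transmitters know the messages of the previous blocks and all receivers
decode correctly. So the error probability is at most the sum of those of the blocks. -/
theorem sum_error_blockMarkovCode_le (W : Channel X₁ X₂ Y) {M₁ M₂ : Type*} {n : ℕ} (hn : 0 < n)
    {N T : ℕ} (hN : (T + 1) * n ≤ N)
    (D : BlockCode (Fin n → X₁) (Fin n → X₂) (Fin n → ∀ k, Y k) (fun k => Fin n → Y k) M₁ M₂)
    (d : M₁ × M₂) (x₁ : X₁) (x₂ : X₂) (z₀ : ∀ k, Y k) {m₁ m₂ : ℕ} [NeZero m₁] [NeZero m₂]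
    {φ₁ : Fin m₁ → ℕ → M₁} {φ₂ : Fin m₂ → ℕ → M₂} (hφ₁ : Function.Injective φ₁)
    (hφ₂ : Function.Injective φ₂) (hd₁ : ∀ w, ∀ t ≥ T, φ₁ w t = d.1)
    (hd₂ : ∀ w, ∀ t ≥ T, φ₂ w t = d.2) (w₁ : Fin m₁) (w₂ : Fin m₂) :
    (∑ y : Fin N → ∀ k, Y k,
      if ∃ k, (blockMarkovCode hn N T D d x₁ x₂ z₀ φ₁ φ₂).dec k (fun i => y i k) ≠ (w₁, w₂) then
        W.outputProb (blockMarkovCode hn N T D d x₁ x₂ z₀ φ₁ φ₂) w₁ w₂ y else 0) ≤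
    ∑ t ∈ Finset.range (T + 1), D.error (W.block n) (fun k z j => z j k)
      (previous d.1 (φ₁ w₁) t, previous d.2 (φ₂ w₂) t) (φ₁ w₁ t, φ₂ w₂ t) := by
  set C := blockMarkovCode hn N T D d x₁ x₂ z₀ φ₁ φ₂ with hC
  set p : ℕ → M₁ × M₂ := fun t => (previous d.1 (φ₁ w₁) t, previous d.2 (φ₂ w₂) t) with hp
  set w : ℕ → M₁ × M₂ := fun t => (φ₁ w₁ t, φ₂ w₂ t) with hw
  set π : ∀ k, (Fin n → ∀ k, Y k) → Fin n → Y k := fun k z j => z j k with hπ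
  -- the inputs of transmitters that know the messages of the previous blocks
  let a₁ : ℕ → X₁ := fun i =>
    if i / n ≤ T then D.enc₁ (p (i / n)) (w (i / n)).1 ⟨i % n, Nat.mod_lt _ hn⟩ else x₁
  let a₂ : ℕ → X₂ := fun i =>
    if i / n ≤ T then D.enc₂ (p (i / n)) (w (i / n)).2 ⟨i % n, Nat.mod_lt _ hn⟩ else x₂
  let ideal : (Fin N → ∀ k, Y k) → ℝ := piLaw fun i : Fin N => W.prob (a₁ i) (a₂ i)
  have hideal : ideal ∈ stdSimplex ℝ (Fin N → ∀ k, Y k) := piLaw_mem fun i => W.prob_mem _ _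
  let good : (Fin N → ∀ k, Y k) → Prop := fun y =>
    ∀ t ≤ T, ¬ D.Bad π (p t) (w t) (blockOf n z₀ y t)
  have hout_nonneg (y) : 0 ≤ W.outputProb C w₁ w₂ y :=
    Finset.prod_nonneg fun i _ => (W.prob_mem _ _).1 _
  have hout_sum : ∑ y, W.outputProb C w₁ w₂ y = 1 :=
    sum_prod_past (fun i h => W.prob (C.enc₁ i w₁ h) (C.enc₂ i w₂ h)) fun i h => (W.prob_mem _ _).2
  have hout (y) (hy : good y) : W.outputProb C w₁ w₂ y = ideal y := by
    refine Finset.prod_congr rfl fun i _ => ?_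
    have e₁ : C.enc₁ i w₁ (past y i) = a₁ i := by
      simp only [hC, blockMarkovCode, a₁]
      split_ifs with hi
      · rw [forward₁_congr D d _ fun r hr => blockOf_past z₀ y i hr, forward₁_eq D d hy hi]
      · rfl
    have e₂ : C.enc₂ i w₂ (past y i) = a₂ i := by
      simp only [hC, blockMarkovCode, a₂]
      split_ifs with hi
      · rw [forward₂_congr D d _ fun r hr => blockOf_past z₀ y i hr, forward₂_eq D d hy hi]
      · rfl
    rw [e₁, e₂]
  have hdec (y) (hy : good y) (k) : C.dec k (fun i => y i k) = (w₁, w₂) := by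
    have hblock : blockOf n (z₀ k) (fun i => y i k) = fun t => π k (blockOf n z₀ y t) := by
      funext t j
      simp only [blockOf, hπ]
      split_ifs <;> rfl
    have hback (t : ℕ) :
        backward D d T k (blockOf n (z₀ k) fun i => y i k) (T - t) = (φ₁ w₁ t, φ₂ w₂ t) := by
      rw [hblock, backward_eq D d hy (Prod.ext (hd₁ _ _ le_rfl) (hd₂ _ _ le_rfl)) k (T.sub_le t)]
      rcases le_total t T with h | h
      · rw [Nat.sub_sub_self h]
      · rw [Nat.sub_eq_zero_of_le h, Nat.sub_zero, hd₁ _ _ le_rfl, hd₂ _ _ le_rfl, hd₁ _ _ h,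
          hd₂ _ _ h]
    simp only [hC, blockMarkovCode, hback]
    exact Prod.ext (Function.leftInverse_invFun hφ₁ w₁) (Function.leftInverse_invFun hφ₂ w₂)
  have hblock (t) (ht : t ≤ T) : expect ideal
      (fun y => if D.Bad π (p t) (w t) (blockOf n z₀ y t) then 1 else 0) =
        D.error (W.block n) π (p t) (w t) := by
    have hlt (j : Fin n) : t * n + j < N := by
      have := Nat.mul_le_mul_right n (Nat.succ_le_succ ht)
      have := j.2
      simp only [Nat.succ_eq_add_one, add_mul, one_mul] at *
      omega
    let e : Fin n → Fin N := fun j => ⟨t * n + j, hlt j⟩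
    have he : Function.Injective e := fun j j' h => by
      have := Fin.mk.inj_iff.1 h
      exact Fin.ext (by omega)
    have h1 (y : Fin N → ∀ k, Y k) : blockOf n z₀ y t = fun j => y (e j) := by
      funext j
      simp only [blockOf, hlt j, dif_pos, e]
    have h2 (j : Fin n) : (t * n + j) / n = t := by
      rw [mul_comm, Nat.mul_add_div hn, Nat.div_eq_of_lt j.2, add_zero]
    have h3 (j : Fin n) : (t * n + j) % n = j := by
      rw [mul_comm, Nat.mul_add_mod, Nat.mod_eq_of_lt j.2]
    simp only [h1, ideal]
    rw [expect_piLaw_comp (fun i => W.prob_mem _ _) he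
      fun z => if D.Bad π (p t) (w t) z then 1 else 0]
    simp only [BlockCode.error, Channel.block, e, a₁, a₂, h2, h3, ht, if_true]
  calc _ ≤ ∑ y, (W.outputProb C w₁ w₂ y - if good y then W.outputProb C w₁ w₂ y else 0) := by
        refine Finset.sum_le_sum fun y _ => ?_
        by_cases hy : good y
        · have : ¬ ∃ k, C.dec k (fun i => y i k) ≠ (w₁, w₂) := fun ⟨k, hk⟩ => hk (hdec y hy k)
          rw [if_neg this, if_pos hy, sub_self]
        · rw [if_neg hy, sub_zero]
          split_ifs
          exacts [le_rfl, hout_nonneg y]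
    _ = ∑ y, (ideal y - if good y then ideal y else 0) := by
        rw [Finset.sum_sub_distrib, Finset.sum_sub_distrib, hout_sum, hideal.2]
        congr 1
        refine Finset.sum_congr rfl fun y _ => ?_
        split_ifs with hy
        exacts [hout y hy, rfl]
    _ ≤ expect ideal fun y => ∑ t ∈ Finset.range (T + 1),
          if D.Bad π (p t) (w t) (blockOf n z₀ y t) then 1 else 0 := by
        refine Finset.sum_le_sum fun y _ => ?_
        have h0 : ∀ t ∈ Finset.range (T + 1),
            (0 : ℝ) ≤ if D.Bad π (p t) (w t) (blockOf n z₀ y t) then 1 else 0 := fun t _ => by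
          split_ifs <;> norm_num
        by_cases hy : good y
        · rw [if_pos hy, sub_self]
          exact mul_nonneg (hideal.1 y) (Finset.sum_nonneg h0)
        · rw [if_neg hy, sub_zero]
          refine le_mul_of_one_le_right (hideal.1 y) ?_
          simp only [good, not_forall, not_not] at hy
          obtain ⟨t, ht, hbad⟩ := hy
          have := Finset.single_le_sum h0 (Finset.mem_range.2 (Nat.lt_succ_of_le ht))
          rwa [if_pos hbad] at this
    _ = _ := by
        rw [expect_sum]
        exact Finset.sum_congr rfl fun t ht => hblock t (Nat.le_of_lt_succ (Finset.mem_range.1 ht))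

/-- If random block codes have small expected error probability, some block Markov code has small
error probability. -/
theorem exists_errorProb_le (W : Channel X₁ X₂ Y) {Γ M₁ M₂ : Type*} [Fintype Γ] {n : ℕ} (hn : 0 < n)
    {N T : ℕ} (hN : (T + 1) * n ≤ N) {μ : Γ → ℝ} (hμ : μ ∈ stdSimplex ℝ Γ)
    (D : Γ → BlockCode (Fin n → X₁) (Fin n → X₂) (Fin n → ∀ k, Y k) (fun k => Fin n → Y k) M₁ M₂)
    (d : M₁ × M₂) (x₁ : X₁) (x₂ : X₂) (z₀ : ∀ k, Y k) {m₁ m₂ : ℕ} [NeZero m₁] [NeZero m₂]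
    {φ₁ : Fin m₁ → ℕ → M₁} {φ₂ : Fin m₂ → ℕ → M₂} (hφ₁ : Function.Injective φ₁)
    (hφ₂ : Function.Injective φ₂) (hd₁ : ∀ w, ∀ t ≥ T, φ₁ w t = d.1)
    (hd₂ : ∀ w, ∀ t ≥ T, φ₂ w t = d.2) {ε : ℝ}
    (hε : ∀ p w, expect μ (fun c => (D c).error (W.block n) (fun k z j => z j k) p w) ≤ ε) :
    ∃ C : FeedbackCode X₁ X₂ Y N m₁ m₂, W.errorProb C ≤ (T + 1) * ε := by
  obtain ⟨c, hc⟩ := exists_le_expect hμ fun c => ∑ w₁ : Fin m₁, ∑ w₂ : Fin m₂,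
    ∑ t ∈ Finset.range (T + 1), (D c).error (W.block n) (fun k z j => z j k)
      (previous d.1 (φ₁ w₁) t, previous d.2 (φ₂ w₂) t) (φ₁ w₁ t, φ₂ w₂ t)
  refine ⟨blockMarkovCode hn N T (D c) d x₁ x₂ z₀ φ₁ φ₂, ?_⟩
  have hm₁ : (0 : ℝ) < m₁ := Nat.cast_pos.2 (NeZero.pos m₁)
  have hm₂ : (0 : ℝ) < m₂ := Nat.cast_pos.2 (NeZero.pos m₂)
  rw [Channel.errorProb, div_le_iff₀ (by positivity)]
  refine (Finset.sum_le_sum fun w₁ _ => Finset.sum_le_sum fun w₂ _ =>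
    sum_error_blockMarkovCode_le W hn hN (D c) d x₁ x₂ z₀ hφ₁ hφ₂ hd₁ hd₂ w₁ w₂).trans ?_
  refine hc.trans ?_
  simp only [expect_sum]
  refine (Finset.sum_le_sum fun w₁ _ => Finset.sum_le_sum fun w₂ _ =>
    Finset.sum_le_sum fun t _ => hε _ _).trans_eq ?_
  simp only [Finset.sum_const, Finset.card_univ, Fintype.card_fin, Finset.card_range, nsmul_eq_mul]
  push_cast
  ring

end BlockMarkov

/-! ### Mutual information as mean information density -/

section Densities

theorem expect_congr {α : Type*} [Fintype α] {p f g : α → ℝ} (h : ∀ a, p a ≠ 0 → f a = g a) :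
    expect p f = expect p g := by
  refine Finset.sum_congr rfl fun a _ => ?_
  by_cases ha : p a = 0
  · rw [ha, zero_mul, zero_mul]
  · rw [h a ha]

theorem mutualInfo_eq_expect {Ω α β : Type*} [Fintype Ω] [Fintype α] [Fintype β] (P : Ω → ℝ)
    (X : Ω → α) (Y : Ω → β) :
    mutualInfo P X Y = expect P fun ω => Real.logb 2
      (law P (fun ω => (X ω, Y ω)) (X ω, Y ω) / (law P X (X ω) * law P Y (Y ω))) := by
  rw [← expect_law P (fun ω => (X ω, Y ω)) fun x =>
    Real.logb 2 (law P (fun ω => (X ω, Y ω)) x / (law P X x.1 * law P Y x.2))]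
  simp only [mutualInfo, expect, Fintype.sum_prod_type]

theorem condMutualInfo_eq_expect {Ω α β γ : Type*} [Fintype Ω] [Fintype α] [Fintype β] [Fintype γ]
    (P : Ω → ℝ) (X : Ω → α) (Y : Ω → β) (Z : Ω → γ) :
    condMutualInfo P X Y Z = expect P fun ω => Real.logb 2
      (law P (fun ω => (X ω, Y ω, Z ω)) (X ω, Y ω, Z ω) * law P Z (Z ω) /
        (law P (fun ω => (X ω, Z ω)) (X ω, Z ω) * law P (fun ω => (Y ω, Z ω)) (Y ω, Z ω))) := by
  rw [← expect_law P (fun ω => (X ω, Y ω, Z ω)) fun x =>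
    Real.logb 2 (law P (fun ω => (X ω, Y ω, Z ω)) x * law P Z x.2.2 /
        (law P (fun ω => (X ω, Z ω)) (x.1, x.2.2) * law P (fun ω => (Y ω, Z ω)) x.2))]
  simp only [condMutualInfo, expect, Fintype.sum_prod_type]

open Classical in
/-- The indicator of a proposition. Unlike a conditional, it carries no decidability instance, in
which a variable could be hidden. -/
def indic (p : Prop) : ℝ := if p then 1 else 0

theorem indic_and (p q : Prop) : indic (p ∧ q) = indic p * indic q := by
  by_cases hp : p <;> by_cases hq : q <;> simp [indic, hp, hq]

theorem indic_nonneg (p : Prop) : 0 ≤ indic p := by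
  by_cases hp : p <;> simp [indic, hp]

theorem law_eq_expect {Ω α : Type*} [Fintype Ω] (P : Ω → ℝ) (X : Ω → α) (a : α) :
    law P X a = expect P fun ω => indic (X ω = a) := by
  simp only [law, expect, indic, mul_ite, mul_one, mul_zero]

theorem expect_indic {α : Type*} [Fintype α] (p : α → ℝ) (a : α) :
    (expect p fun x => indic (x = a)) = p a := by
  classical simp [expect, indic]

theorem expect_indic_mul {α : Type*} [Fintype α] (p f : α → ℝ) (a : α) :
    (expect p fun x => indic (x = a) * f x) = p a * f a := by
  classical simp [expect, indic]

theorem expect_mul_indic {α : Type*} [Fintype α] (p f : α → ℝ) (a : α) :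
    (expect p fun x => f x * indic (x = a)) = p a * f a := by
  classical simp [expect, indic]

theorem expect_pos {α : Type*} [Fintype α] {p f : α → ℝ} (hp : p ∈ stdSimplex ℝ α)
    (hf : ∀ a, 0 ≤ f a) {a : α} (ha : 0 < p a) (hfa : 0 < f a) : 0 < expect p f :=
  (mul_pos ha hfa).trans_le (Finset.single_le_sum (f := fun a => p a * f a)
    (fun a _ => mul_nonneg (hp.1 a) (hf a)) (Finset.mem_univ a))

theorem law_of_injective {Ω α : Type*} [Fintype Ω] (P : Ω → ℝ) {X : Ω → α}
    (hX : Function.Injective X) (ω : Ω) : law P X (X ω) = P ω := by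
  classical simp [law, hX.eq_iff]

theorem law_pos {Ω α : Type*} [Fintype Ω] {P : Ω → ℝ} (hP : P ∈ stdSimplex ℝ Ω) (X : Ω → α) {ω : Ω}
    (hω : 0 < P ω) : 0 < law P X (X ω) := by
  rw [law_eq_expect]
  exact expect_pos hP (fun ω' => indic_nonneg _) hω (by simp [indic])

variable {X₁ X₂ : Type*} {K : ℕ} {Y : Fin K → Type*} [∀ k, Fintype (Y k)]
  (W : Channel X₁ X₂ Y) {U : Type*} {pU : U → ℝ} {q₁ : U → X₁ → ℝ} {q₂ : U → X₂ → ℝ}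

theorem Channel.joint_eq (pU : U → ℝ) (q₁ : U → X₁ → ℝ) (q₂ : U → X₂ → ℝ) :
    W.joint pU q₁ q₂ =
      compLaw pU fun u => compLaw (q₁ u) fun a => compLaw (q₂ u) fun b => W.prob a b := by
  funext ω
  simp only [Channel.joint, compLaw, mul_assoc]

variable [Fintype X₁] [Fintype X₂] [Fintype U]

theorem Channel.joint_mem (hU : pU ∈ stdSimplex ℝ U) (hq₁ : ∀ u, q₁ u ∈ stdSimplex ℝ X₁)
    (hq₂ : ∀ u, q₂ u ∈ stdSimplex ℝ X₂) :
    W.joint pU q₁ q₂ ∈ stdSimplex ℝ (U × X₁ × X₂ × ∀ k, Y k) := by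
  rw [W.joint_eq]
  exact compLaw_mem hU fun u => compLaw_mem (hq₁ u) fun a => compLaw_mem (hq₂ u) fun b =>
    W.prob_mem a b

theorem Channel.pos_of_joint_ne_zero (hU : pU ∈ stdSimplex ℝ U)
    (hq₁ : ∀ u, q₁ u ∈ stdSimplex ℝ X₁) (hq₂ : ∀ u, q₂ u ∈ stdSimplex ℝ X₂)
    {ω : U × X₁ × X₂ × ∀ k, Y k} (hω : W.joint pU q₁ q₂ ω ≠ 0) :
    0 < pU ω.1 ∧ 0 < q₁ ω.1 ω.2.1 ∧ 0 < q₂ ω.1 ω.2.2.1 ∧ 0 < W.prob ω.2.1 ω.2.2.1 ω.2.2.2 := by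
  simp only [Channel.joint, ne_eq, mul_eq_zero, not_or] at hω
  exact ⟨(hU.1 _).lt_of_ne' hω.1.1.1, ((hq₁ _).1 _).lt_of_ne' hω.1.1.2,
    ((hq₂ _).1 _).lt_of_ne' hω.1.2, ((W.prob_mem _ _).1 _).lt_of_ne' hω.2⟩

/-- The conditional mutual information is the mean of `log p(z | a, b) / p(z | u, b)`. -/
theorem Channel.condMutualInfo_joint₁ (hU : pU ∈ stdSimplex ℝ U)
    (hq₁ : ∀ u, q₁ u ∈ stdSimplex ℝ X₁) (hq₂ : ∀ u, q₂ u ∈ stdSimplex ℝ X₂) :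
    condMutualInfo (W.joint pU q₁ q₂) (fun ω => ω.2.1) (fun ω => ω.2.2.2)
        (fun ω => (ω.2.2.1, ω.1)) =
      expect (W.joint pU q₁ q₂) fun ω => Real.logb 2 (W.prob ω.2.1 ω.2.2.1 ω.2.2.2 /
        expect (q₁ ω.1) fun a => W.prob a ω.2.2.1 ω.2.2.2) := by
  rw [condMutualInfo_eq_expect]
  refine expect_congr fun ω hω => ?_
  obtain ⟨h1, h2, h3, h4⟩ := W.pos_of_joint_ne_zero hU hq₁ hq₂ hω
  obtain ⟨u, a, b, z⟩ := ω
  simp only at h1 h2 h3 h4 ⊢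
  have hc (c : ℝ) (a b) : expect (W.prob a b) (fun _ => c) = c := expect_const (W.prob_mem a b) c
  have hc₁ (c : ℝ) (u) : expect (q₁ u) (fun _ => c) = c := expect_const (hq₁ u) c
  have hc₂ (c : ℝ) (u) : expect (q₂ u) (fun _ => c) = c := expect_const (hq₂ u) c
  have e1 : law (W.joint pU q₁ q₂) (fun ω => (ω.2.1, ω.2.2.2, ω.2.2.1, ω.1)) (a, z, b, u) =
      pU u * (q₁ u a * (q₂ u b * W.prob a b z)) := by
    refine (law_of_injective (W.joint pU q₁ q₂) (fun ω ω' h => ?_) (u, a, b, z)).trans ?_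
    · simp only [Prod.mk.injEq] at h
      simp only [Prod.ext_iff, h, true_and]
    · simp only [Channel.joint, mul_assoc]
  have e2 : law (W.joint pU q₁ q₂) (fun ω => (ω.2.2.1, ω.1)) (b, u) = pU u * q₂ u b := by
    simp only [W.joint_eq, law_eq_expect, expect_compLaw, Prod.mk.injEq, indic_and, hc,
      hc₁, expect_mul_const, expect_mul_indic, expect_indic]
  have e3 : law (W.joint pU q₁ q₂) (fun ω => (ω.2.1, ω.2.2.1, ω.1)) (a, b, u) =
      pU u * (q₁ u a * q₂ u b) := by
    simp only [W.joint_eq, law_eq_expect, expect_compLaw, Prod.mk.injEq, indic_and, ← mul_assoc, hc,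
      expect_mul_const, expect_const_mul, expect_mul_indic, expect_indic]
  have e4 : law (W.joint pU q₁ q₂) (fun ω => (ω.2.2.2, ω.2.2.1, ω.1)) (z, b, u) =
      pU u * (q₂ u b * expect (q₁ u) fun a => W.prob a b z) := by
    simp only [W.joint_eq, law_eq_expect, expect_compLaw, Prod.mk.injEq, indic_and, ← mul_assoc,
      expect_mul_const, expect_const_mul, expect_mul_indic, expect_indic]
  have h5 : 0 < expect (q₁ u) fun a => W.prob a b z :=
    expect_pos (hq₁ u) (fun a => (W.prob_mem a b).1 z) h2 h4
  rw [e1, e2, e3, e4]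
  congr 1
  field_simp

/-- The conditional mutual information is the mean of `log p(z | a, b) / p(z | u, a)`. -/
theorem Channel.condMutualInfo_joint₂ (hU : pU ∈ stdSimplex ℝ U)
    (hq₁ : ∀ u, q₁ u ∈ stdSimplex ℝ X₁) (hq₂ : ∀ u, q₂ u ∈ stdSimplex ℝ X₂) :
    condMutualInfo (W.joint pU q₁ q₂) (fun ω => ω.2.2.1) (fun ω => ω.2.2.2)
        (fun ω => (ω.2.1, ω.1)) =
      expect (W.joint pU q₁ q₂) fun ω => Real.logb 2 (W.prob ω.2.1 ω.2.2.1 ω.2.2.2 /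
        expect (q₂ ω.1) fun b => W.prob ω.2.1 b ω.2.2.2) := by
  rw [condMutualInfo_eq_expect]
  refine expect_congr fun ω hω => ?_
  obtain ⟨h1, h2, h3, h4⟩ := W.pos_of_joint_ne_zero hU hq₁ hq₂ hω
  obtain ⟨u, a, b, z⟩ := ω
  simp only at h1 h2 h3 h4 ⊢
  have hc (c : ℝ) (a b) : expect (W.prob a b) (fun _ => c) = c := expect_const (W.prob_mem a b) c
  have hc₁ (c : ℝ) (u) : expect (q₁ u) (fun _ => c) = c := expect_const (hq₁ u) c
  have hc₂ (c : ℝ) (u) : expect (q₂ u) (fun _ => c) = c := expect_const (hq₂ u) c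
  have e1 : law (W.joint pU q₁ q₂) (fun ω => (ω.2.2.1, ω.2.2.2, ω.2.1, ω.1)) (b, z, a, u) =
      pU u * (q₁ u a * (q₂ u b * W.prob a b z)) := by
    refine (law_of_injective (W.joint pU q₁ q₂) (fun ω ω' h => ?_) (u, a, b, z)).trans ?_
    · simp only [Prod.mk.injEq] at h
      simp only [Prod.ext_iff, h, true_and]
    · simp only [Channel.joint, mul_assoc]
  have e2 : law (W.joint pU q₁ q₂) (fun ω => (ω.2.1, ω.1)) (a, u) = pU u * q₁ u a := by
    simp only [W.joint_eq, law_eq_expect, expect_compLaw, Prod.mk.injEq, indic_and, hc,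
      hc₂, expect_mul_const, expect_mul_indic, expect_indic]
  have e3 : law (W.joint pU q₁ q₂) (fun ω => (ω.2.2.1, ω.2.1, ω.1)) (b, a, u) =
      pU u * (q₁ u a * q₂ u b) := by
    simp only [W.joint_eq, law_eq_expect, expect_compLaw, Prod.mk.injEq, indic_and, ← mul_assoc, hc,
      expect_mul_const, expect_const_mul, expect_mul_indic, expect_indic]
    ring
  have e4 : law (W.joint pU q₁ q₂) (fun ω => (ω.2.2.2, ω.2.1, ω.1)) (z, a, u) =
      pU u * (q₁ u a * expect (q₂ u) fun b => W.prob a b z) := by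
    simp only [W.joint_eq, law_eq_expect, expect_compLaw, Prod.mk.injEq, indic_and, ← mul_assoc,
      expect_mul_const, expect_mul_indic, expect_indic]
  have h5 : 0 < expect (q₂ u) fun b => W.prob a b z :=
    expect_pos (hq₂ u) (fun b => (W.prob_mem a b).1 z) h3 h4
  rw [e1, e2, e3, e4]
  congr 1
  field_simp

theorem Channel.receiverLaw_pos (hU : pU ∈ stdSimplex ℝ U)
    (hq₁ : ∀ u, q₁ u ∈ stdSimplex ℝ X₁) (hq₂ : ∀ u, q₂ u ∈ stdSimplex ℝ X₂)
    {ω : U × X₁ × X₂ × ∀ k, Y k} (hω : W.joint pU q₁ q₂ ω ≠ 0) (k : Fin K) :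
    0 < receiverLaw W.prob (fun k z => z k) pU q₁ q₂ k (ω.2.2.2 k) := by
  obtain ⟨h1, h2, h3, h4⟩ := W.pos_of_joint_ne_zero hU hq₁ hq₂ hω
  have h0 (a b) : 0 ≤ law (W.prob a b) (fun z => z k) (ω.2.2.2 k) :=
    (law_mem (W.prob_mem a b) _).1 _
  refine expect_pos hU (fun u => expect_nonneg (hq₁ u) fun a => expect_nonneg (hq₂ u) fun b =>
    h0 a b) h1 ?_
  refine expect_pos (hq₁ _) (fun a => expect_nonneg (hq₂ _) fun b => h0 a b) h2 ?_
  exact expect_pos (hq₂ _) (fun b => h0 _ b) h3 (law_pos (W.prob_mem _ _) _ h4)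

/-- The mutual information is the mean of `log p(v | a, b) / p(v)`, where `v` is the output of
receiver `k`. -/
theorem Channel.mutualInfo_joint (hU : pU ∈ stdSimplex ℝ U)
    (hq₁ : ∀ u, q₁ u ∈ stdSimplex ℝ X₁) (hq₂ : ∀ u, q₂ u ∈ stdSimplex ℝ X₂) (k : Fin K) :
    mutualInfo (W.joint pU q₁ q₂) (fun ω => (ω.2.1, ω.2.2.1)) (fun ω => ω.2.2.2 k) =
      expect (W.joint pU q₁ q₂) fun ω => Real.logb 2
        (law (W.prob ω.2.1 ω.2.2.1) (fun z => z k) (ω.2.2.2 k) /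
          receiverLaw W.prob (fun k z => z k) pU q₁ q₂ k (ω.2.2.2 k)) := by
  rw [mutualInfo_eq_expect]
  refine expect_congr fun ω hω => ?_
  have h5 := W.receiverLaw_pos hU hq₁ hq₂ hω k
  obtain ⟨h1, h2, h3, h4⟩ := W.pos_of_joint_ne_zero hU hq₁ hq₂ hω
  obtain ⟨u, a, b, z⟩ := ω
  simp only at h1 h2 h3 h4 h5 ⊢
  have hc (c : ℝ) (a b) : expect (W.prob a b) (fun _ => c) = c := expect_const (W.prob_mem a b) c
  have e1 : law (W.joint pU q₁ q₂) (fun ω => ((ω.2.1, ω.2.2.1), ω.2.2.2 k)) ((a, b), z k) =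
      (expect pU fun u => q₁ u a * q₂ u b) * law (W.prob a b) (fun z => z k) (z k) := by
    simp only [W.joint_eq, law_eq_expect, expect_compLaw, Prod.mk.injEq, indic_and, mul_assoc,
      expect_const_mul, expect_indic_mul]
    simp only [← mul_assoc, expect_mul_const]
  have e2 : law (W.joint pU q₁ q₂) (fun ω => (ω.2.1, ω.2.2.1)) (a, b) =
      expect pU fun u => q₁ u a * q₂ u b := by
    simp only [W.joint_eq, law_eq_expect, expect_compLaw, Prod.mk.injEq, indic_and, hc,
      expect_const_mul, expect_indic_mul, expect_indic]
  have e3 : law (W.joint pU q₁ q₂) (fun ω => ω.2.2.2 k) (z k) =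
      receiverLaw W.prob (fun k z => z k) pU q₁ q₂ k (z k) := by
    simp only [W.joint_eq, law_eq_expect, expect_compLaw, receiverLaw]
  have h6 : 0 < expect pU fun u => q₁ u a * q₂ u b :=
    expect_pos hU (fun u => mul_nonneg ((hq₁ u).1 a) ((hq₂ u).1 b)) h1 (mul_pos h2 h3)
  rw [e1, e2, e3, mul_div_mul_left _ _ h6.ne']

end Densities

/-! ### Long blocks -/

section Asymptotics

open Classical in
/-- The information density of a long block exceeds its mean, up to an error of `δ` for each
symbol, with probability tending to one. -/
theorem tendsto_density {Ω : Type*} [Fintype Ω] {p : Ω → ℝ} (hp : p ∈ stdSimplex ℝ Ω)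
    {num den : Ω → ℝ} (hpos : ∀ ω, p ω ≠ 0 → 0 < num ω ∧ 0 < den ω) {δ : ℝ} (hδ : 0 < δ) :
    Tendsto (fun n : ℕ => expect (piLaw fun _ : Fin n => p) fun f =>
      if (2 : ℝ) ^ ((n : ℝ) * ((expect p fun ω => Real.logb 2 (num ω / den ω)) - δ)) *
        ∏ j, den (f j) < ∏ j, num (f j) then 0 else 1) atTop (𝓝 0) := by
  set g : Ω → ℝ := fun ω => Real.logb 2 (num ω / den ω) with hg
  refine squeeze_zero' (.of_forall fun n => expect_nonneg (piLaw_mem fun _ => hp) fun f => ?_)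
    ((eventually_gt_atTop 0).mono fun n hn => ?_)
    (tendsto_const_div_atTop_nhds_zero_nat (expect p (fun a => (g a - expect p g) ^ 2) / δ ^ 2))
  · split_ifs <;> norm_num
  refine le_trans (Finset.sum_le_sum fun f _ => ?_) (expect_piLaw_sum_le hp g hδ hn)
  by_cases hf : piLaw (fun _ : Fin n => p) f = 0
  · rw [hf, zero_mul, zero_mul]
  refine mul_le_mul_of_nonneg_left ?_ ((piLaw_mem fun _ => hp).1 f)
  have hpos' (j) := hpos (f j) (Finset.prod_ne_zero_iff.1 hf j (Finset.mem_univ j))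
  have hden : 0 < ∏ j, den (f j) := Finset.prod_pos fun j _ => (hpos' j).2
  have hnum : 0 < ∏ j, num (f j) := Finset.prod_pos fun j _ => (hpos' j).1
  have hsum : ∑ j, g (f j) = Real.logb 2 ((∏ j, num (f j)) / ∏ j, den (f j)) := by
    rw [← Finset.prod_div_distrib, Real.logb_prod _ _ fun j _ =>
      (div_pos (hpos' j).1 (hpos' j).2).ne']
  beta_reduce
  rw [hsum]
  split_ifs with h1 h2 h2
  · norm_num
  · norm_num
  · norm_num
  · exfalso
    rw [not_le, Real.lt_logb_iff_rpow_lt one_lt_two (div_pos hnum hden), lt_div_iff₀ hden] at h2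
    exact h1 h2

theorem law_piLaw {ι α β : Type*} [Fintype ι] [DecidableEq ι] [Fintype α] (q : ι → α → ℝ)
    (X : α → β) (v : ι → β) :
    law (piLaw q) (fun f i => X (f i)) v = ∏ i, law (q i) X (v i) := by
  have (f : ι → α) : indic ((fun i => X (f i)) = v) = ∏ i, indic (X (f i) = v i) := by
    by_cases h : (fun i => X (f i)) = v
    · subst h
      simp [indic]
    · obtain ⟨i, hi⟩ := Function.ne_iff.1 h
      rw [Finset.prod_eq_zero (Finset.mem_univ i) (by simpa [indic] using hi)]
      simp [indic, h]
  simp only [law_eq_expect, this]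
  exact expect_piLaw_prod q fun i a => indic (X a = v i)

variable {X₁ X₂ : Type*} [Fintype X₁] [Fintype X₂] {K : ℕ} {Y : Fin K → Type*} [∀ k, Fintype (Y k)]
  (W : Channel X₁ X₂ Y) {U : Type*} [Fintype U] {pU : U → ℝ} {q₁ : U → X₁ → ℝ} {q₂ : U → X₂ → ℝ}

theorem Channel.expect_piLaw_joint {n : ℕ} (F : (Fin n → U) → (Fin n → X₁) → (Fin n → X₂) →
    (Fin n → ∀ k, Y k) → ℝ) :
    expect (piLaw fun _ : Fin n => W.joint pU q₁ q₂) (fun f => F (fun j => (f j).1)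
        (fun j => (f j).2.1) (fun j => (f j).2.2.1) fun j => (f j).2.2.2) =
      expect (piLaw fun _ => pU) fun u => expect (piLaw fun j => q₁ (u j)) fun a =>
        expect (piLaw fun j => q₂ (u j)) fun b => expect (W.block n a b) fun z => F u a b z := by
  rw [W.joint_eq]
  refine (expect_piLaw_compLaw _ _ fun u (f : Fin n → X₁ × X₂ × ∀ k, Y k) => F u (fun j => (f j).1)
        (fun j => (f j).2.1) fun j => (f j).2.2).trans ?_
  congr 1; funext u
  refine (expect_piLaw_compLaw _ _ fun a (f : Fin n → X₂ × ∀ k, Y k) =>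
    F u a (fun j => (f j).1) fun j => (f j).2).trans ?_
  congr 1; funext a
  exact expect_piLaw_compLaw _ _ fun b z => F u a b z

theorem Channel.receiverLaw_block {n : ℕ} (k : Fin K) (v : Fin n → Y k) :
    receiverLaw (W.block n) (fun k z j => z j k) (piLaw fun _ => pU)
      (fun u => piLaw fun j => q₁ (u j)) (fun u => piLaw fun j => q₂ (u j)) k v =
      ∏ j, receiverLaw W.prob (fun k z => z k) pU q₁ q₂ k (v j) := by
  have h1 (a : Fin n → X₁) (b : Fin n → X₂) : law (W.block n a b) (fun z j => z j k) v =
      ∏ j, law (W.prob (a j) (b j)) (fun z => z k) (v j) :=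
    law_piLaw (fun j => W.prob (a j) (b j)) (fun z => z k) v
  have h2 (u : Fin n → U) (a : Fin n → X₁) := expect_piLaw_prod (fun j => q₂ (u j))
    fun j b => law (W.prob (a j) b) (fun z => z k) (v j)
  have h3 (u : Fin n → U) := expect_piLaw_prod (fun j => q₁ (u j))
    fun j a => expect (q₂ (u j)) fun b => law (W.prob a b) (fun z => z k) (v j)
  simp only [receiverLaw, h1, h2, h3]
  exact expect_piLaw_prod (fun _ => pU) fun j u => expect (q₁ u) fun a => expect (q₂ u) fun b =>
    law (W.prob a b) (fun z => z k) (v j)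

open Classical in
theorem Channel.tendsto_density₁
    (hU : pU ∈ stdSimplex ℝ U) (hq₁ : ∀ u, q₁ u ∈ stdSimplex ℝ X₁)
    (hq₂ : ∀ u, q₂ u ∈ stdSimplex ℝ X₂) {δ : ℝ} (hδ : 0 < δ) :
    Tendsto (fun n : ℕ => expect (piLaw fun _ : Fin n => pU) fun u =>
      expect (piLaw fun j => q₁ (u j)) fun a => expect (piLaw fun j => q₂ (u j)) fun b =>
        expect (W.block n a b) fun z =>
          if (2 : ℝ) ^ ((n : ℝ) * (condMutualInfo (W.joint pU q₁ q₂) (fun ω => ω.2.1)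
              (fun ω => ω.2.2.2) (fun ω => (ω.2.2.1, ω.1)) - δ)) *
            (expect (piLaw fun j => q₁ (u j)) fun a' => W.block n a' b z) < W.block n a b z
          then 0 else 1) atTop (𝓝 0) := by
  have h := tendsto_density (W.joint_mem hU hq₁ hq₂)
    (num := fun ω => W.prob ω.2.1 ω.2.2.1 ω.2.2.2)
    (den := fun ω => expect (q₁ ω.1) fun a => W.prob a ω.2.2.1 ω.2.2.2) (fun ω hω => by
      obtain ⟨-, h2, -, h4⟩ := W.pos_of_joint_ne_zero hU hq₁ hq₂ hω
      exact ⟨h4, expect_pos (hq₁ _) (fun a => (W.prob_mem a _).1 _) h2 h4⟩) hδ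
  rw [← W.condMutualInfo_joint₁ hU hq₁ hq₂] at h
  refine h.congr fun n => ?_
  rw [← W.expect_piLaw_joint]
  congr 1; funext f
  rw [← expect_piLaw_prod (fun j => q₁ (f j).1) fun j a => W.prob a (f j).2.2.1 (f j).2.2.2]
  rfl

open Classical in
theorem Channel.tendsto_density₂
    (hU : pU ∈ stdSimplex ℝ U) (hq₁ : ∀ u, q₁ u ∈ stdSimplex ℝ X₁)
    (hq₂ : ∀ u, q₂ u ∈ stdSimplex ℝ X₂) {δ : ℝ} (hδ : 0 < δ) :
    Tendsto (fun n : ℕ => expect (piLaw fun _ : Fin n => pU) fun u =>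
      expect (piLaw fun j => q₁ (u j)) fun a => expect (piLaw fun j => q₂ (u j)) fun b =>
        expect (W.block n a b) fun z =>
          if (2 : ℝ) ^ ((n : ℝ) * (condMutualInfo (W.joint pU q₁ q₂) (fun ω => ω.2.2.1)
              (fun ω => ω.2.2.2) (fun ω => (ω.2.1, ω.1)) - δ)) *
            (expect (piLaw fun j => q₂ (u j)) fun b' => W.block n a b' z) < W.block n a b z
          then 0 else 1) atTop (𝓝 0) := by
  have h := tendsto_density (W.joint_mem hU hq₁ hq₂)
    (num := fun ω => W.prob ω.2.1 ω.2.2.1 ω.2.2.2)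
    (den := fun ω => expect (q₂ ω.1) fun b => W.prob ω.2.1 b ω.2.2.2) (fun ω hω => by
      obtain ⟨-, -, h3, h4⟩ := W.pos_of_joint_ne_zero hU hq₁ hq₂ hω
      exact ⟨h4, expect_pos (hq₂ _) (fun b => (W.prob_mem _ b).1 _) h3 h4⟩) hδ
  rw [← W.condMutualInfo_joint₂ hU hq₁ hq₂] at h
  refine h.congr fun n => ?_
  rw [← W.expect_piLaw_joint]
  congr 1; funext f
  rw [← expect_piLaw_prod (fun j => q₂ (f j).1) fun j b => W.prob (f j).2.1 b (f j).2.2.2]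
  rfl

open Classical in
theorem Channel.tendsto_density_receiver
    (hU : pU ∈ stdSimplex ℝ U) (hq₁ : ∀ u, q₁ u ∈ stdSimplex ℝ X₁)
    (hq₂ : ∀ u, q₂ u ∈ stdSimplex ℝ X₂) {δ : ℝ} (hδ : 0 < δ) (k : Fin K) :
    Tendsto (fun n : ℕ => expect (piLaw fun _ : Fin n => pU) fun u =>
      expect (piLaw fun j => q₁ (u j)) fun a => expect (piLaw fun j => q₂ (u j)) fun b =>
        expect (W.block n a b) fun z =>
          if (2 : ℝ) ^ ((n : ℝ) * (mutualInfo (W.joint pU q₁ q₂) (fun ω => (ω.2.1, ω.2.2.1))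
              (fun ω => ω.2.2.2 k) - δ)) *
            receiverLaw (W.block n) (fun k z j => z j k) (piLaw fun _ => pU)
              (fun u => piLaw fun j => q₁ (u j)) (fun u => piLaw fun j => q₂ (u j)) k
              (fun j => z j k) < law (W.block n a b) (fun z j => z j k) (fun j => z j k)
          then 0 else 1) atTop (𝓝 0) := by
  have h := tendsto_density (W.joint_mem hU hq₁ hq₂)
    (num := fun ω => law (W.prob ω.2.1 ω.2.2.1) (fun z => z k) (ω.2.2.2 k))
    (den := fun ω => receiverLaw W.prob (fun k z => z k) pU q₁ q₂ k (ω.2.2.2 k)) (fun ω hω =>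
      ⟨law_pos (W.prob_mem _ _) _ (W.pos_of_joint_ne_zero hU hq₁ hq₂ hω).2.2.2,
        W.receiverLaw_pos hU hq₁ hq₂ hω k⟩) hδ
  rw [← W.mutualInfo_joint hU hq₁ hq₂] at h
  refine h.congr fun n => ?_
  rw [← W.expect_piLaw_joint]
  congr 1; funext f
  rw [W.receiverLaw_block k, ← law_piLaw (fun j => W.prob (f j).2.1 (f j).2.2.1) (fun z => z k)]
  rfl

theorem numMessages_zero (n : ℕ) : numMessages n 0 = 1 := by
  simp [numMessages]

theorem one_le_numMessages (n : ℕ) (r : ℝ) : 1 ≤ numMessages n r :=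
  Nat.one_le_iff_ne_zero.2 (Nat.ceil_pos.2 (by positivity)).ne'

instance (n : ℕ) (r : ℝ) : NeZero (numMessages n r) :=
  ⟨Nat.one_le_iff_ne_zero.1 (one_le_numMessages n r)⟩

theorem numMessages_lt (n : ℕ) (r : ℝ) : (numMessages n r : ℝ) < 2 ^ ((n : ℝ) * r) + 1 :=
  Nat.ceil_lt_add_one (by positivity)

theorem tendsto_two_rpow_mul {c : ℝ} (hc : c < 0) :
    Tendsto (fun n : ℕ => (2 : ℝ) ^ ((n : ℝ) * c)) atTop (𝓝 0) := by
  have h := tendsto_pow_atTop_nhds_zero_of_lt_one (r := (2 : ℝ) ^ c) (by positivity)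
    (Real.rpow_lt_one_of_one_lt_of_neg one_lt_two hc)
  refine h.congr fun n => ?_
  rw [← Real.rpow_natCast, ← Real.rpow_mul zero_le_two, mul_comm]

theorem tendsto_numMessages {r I : ℝ} (h : r = 0 ∨ r < I) :
    Tendsto (fun n : ℕ => ((numMessages n r : ℝ) - 1) * (1 / 2 ^ ((n : ℝ) * I))) atTop (𝓝 0) := by
  rcases h with rfl | h
  · simp [numMessages_zero]
  refine squeeze_zero (fun n => mul_nonneg ?_ (by positivity)) (fun n => ?_)
    (tendsto_two_rpow_mul (sub_neg.2 h))
  · exact sub_nonneg.2 (Nat.one_le_cast.2 (one_le_numMessages n r))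
  · rw [mul_sub, Real.rpow_sub two_pos, mul_one_div]
    gcongr
    linarith [numMessages_lt n r]

theorem tendsto_numMessages_mul {r₁ r₂ I : ℝ} (h₁ : 0 ≤ r₁) (h₂ : 0 ≤ r₂) (h : r₁ + r₂ < I) :
    Tendsto (fun n : ℕ => ((numMessages n r₁ : ℝ) * numMessages n r₂ - 1) *
      (1 / 2 ^ ((n : ℝ) * I))) atTop (𝓝 0) := by
  have h0 := (tendsto_two_rpow_mul (sub_neg.2 h)).const_mul 4
  rw [mul_zero] at h0
  have hle (n : ℕ) {r : ℝ} (hr : 0 ≤ r) : (numMessages n r : ℝ) ≤ 2 * 2 ^ ((n : ℝ) * r) := by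
    have := Real.one_le_rpow (x := 2) one_le_two (mul_nonneg n.cast_nonneg hr)
    linarith [numMessages_lt n r]
  refine squeeze_zero (fun n => mul_nonneg ?_ (by positivity)) (fun n => ?_) h0
  · exact sub_nonneg.2 (one_le_mul_of_one_le_of_one_le
      (Nat.one_le_cast.2 (one_le_numMessages n r₁)) (Nat.one_le_cast.2 (one_le_numMessages n r₂)))
  · rw [mul_sub, mul_add, Real.rpow_sub two_pos, Real.rpow_add two_pos, mul_one_div,
      ← mul_div_assoc]
    gcongr
    have := mul_le_mul (hle n h₁) (hle n h₂) (Nat.cast_nonneg _) (by positivity)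
    linarith

/-- A message is split into `T` messages of smaller sets, followed by dummy messages. -/
theorem exists_split {m M : ℕ} [NeZero M] {T : ℕ} (h : m ≤ M ^ T) :
    ∃ φ : Fin m → ℕ → Fin M, Function.Injective φ ∧ ∀ w, ∀ t ≥ T, φ w t = 0 := by
  obtain ⟨e⟩ : Nonempty (Fin m ↪ (Fin T → Fin M)) :=
    Function.Embedding.nonempty_of_card_le (by simpa using h)
  refine ⟨fun w t => if ht : t < T then e w ⟨t, ht⟩ else 0, fun w w' hw => ?_, fun w t ht => ?_⟩
  · refine e.injective (funext fun t => ?_)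
    simpa using congrFun hw t
  · exact dif_neg (not_lt.2 ht)

theorem numMessages_le_pow {N n T : ℕ} {R r : ℝ} (h : (N : ℝ) * R ≤ T * (n * r)) :
    numMessages N R ≤ numMessages n r ^ T := by
  refine Nat.ceil_le.2 ?_
  push_cast
  calc (2 : ℝ) ^ ((N : ℝ) * R) ≤ 2 ^ ((T : ℝ) * (n * r)) :=
        Real.rpow_le_rpow_of_exponent_le one_le_two h
    _ = (2 ^ ((n : ℝ) * r)) ^ T := by
        rw [← Real.rpow_natCast, ← Real.rpow_mul zero_le_two, mul_comm]
    _ ≤ _ := by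
        gcongr
        exact Nat.le_ceil _

end Asymptotics

/-! ### Achievability -/

section Achievability

variable {X₁ X₂ : Type*} {K : ℕ} {Y : Fin K → Type*} [∀ k, Fintype (Y k)] (W : Channel X₁ X₂ Y)

theorem Channel.errorProb_nonneg {N M₁ M₂ : ℕ} (C : FeedbackCode X₁ X₂ Y N M₁ M₂) :
    0 ≤ W.errorProb C := by
  refine div_nonneg (Finset.sum_nonneg fun w₁ _ => Finset.sum_nonneg fun w₂ _ =>
    Finset.sum_nonneg fun y _ => ?_) (by positivity)
  split_ifs
  exacts [Finset.prod_nonneg fun i _ => (W.prob_mem _ _).1 _, le_rfl]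

theorem Channel.achievable_of_eventually [Nonempty X₁] [Nonempty X₂] {R₁ R₂ : ℝ} (hR₁ : 0 ≤ R₁)
    (hR₂ : 0 ≤ R₂) {ε : ℕ → ℝ} (hε : Tendsto ε atTop (𝓝 0))
    (h : ∀ᶠ N in atTop, ∃ C : FeedbackCode X₁ X₂ Y N (numMessages N R₁) (numMessages N R₂),
      W.errorProb C ≤ ε N) : W.Achievable (R₁, R₂) := by
  classical
  let default (N : ℕ) : FeedbackCode X₁ X₂ Y N (numMessages N R₁) (numMessages N R₂) :=
    ⟨fun _ _ _ => Classical.arbitrary X₁, fun _ _ _ => Classical.arbitrary X₂, fun _ _ => (0, 0)⟩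
  refine ⟨hR₁, hR₂, fun N => if hN : ∃ C : FeedbackCode X₁ X₂ Y N (numMessages N R₁)
    (numMessages N R₂), W.errorProb C ≤ ε N then hN.choose else default N, ?_⟩
  refine squeeze_zero' (.of_forall fun N => W.errorProb_nonneg _) (h.mono fun N hN => ?_) hε
  beta_reduce
  rw [dif_pos hN]
  exact hN.choose_spec

/-- At rate zero there is only one pair of messages, so no error is possible. -/
theorem Channel.achievable_zero [Nonempty X₁] [Nonempty X₂] : W.Achievable (0, 0) := by
  refine W.achievable_of_eventually le_rfl le_rfl tendsto_const_nhds (.of_forall fun N => ?_)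
  have : Subsingleton (Fin (numMessages N 0)) := by
    rw [numMessages_zero]
    infer_instance
  refine ⟨⟨fun _ _ _ => Classical.arbitrary X₁, fun _ _ _ => Classical.arbitrary X₂,
    fun _ _ => (0, 0)⟩, le_of_eq ?_⟩
  refine div_eq_zero_iff.2 (.inl <| Finset.sum_eq_zero fun w₁ _ => Finset.sum_eq_zero fun w₂ _ =>
    Finset.sum_eq_zero fun y _ => if_neg fun ⟨k, hk⟩ => hk (Subsingleton.elim _ _))

variable [Fintype X₁] [Fintype X₂] {U : Type*} [Fintype U] {pU : U → ℝ} {q₁ : U → X₁ → ℝ}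
  {q₂ : U → X₂ → ℝ}

theorem Channel.tendsto_randomCodingBound (hU : pU ∈ stdSimplex ℝ U)
    (hq₁ : ∀ u, q₁ u ∈ stdSimplex ℝ X₁) (hq₂ : ∀ u, q₂ u ∈ stdSimplex ℝ X₂)
    {r₁ r₂ δ₁ δ₂ δ : ℝ} (hr₁ : 0 ≤ r₁) (hr₂ : 0 ≤ r₂) (hδ₁ : 0 < δ₁) (hδ₂ : 0 < δ₂) (hδ : 0 < δ)
    (h₁ : r₁ = 0 ∨ r₁ < condMutualInfo (W.joint pU q₁ q₂) (fun ω => ω.2.1) (fun ω => ω.2.2.2)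
      (fun ω => (ω.2.2.1, ω.1)) - δ₁)
    (h₂ : r₂ = 0 ∨ r₂ < condMutualInfo (W.joint pU q₁ q₂) (fun ω => ω.2.2.1) (fun ω => ω.2.2.2)
      (fun ω => (ω.2.1, ω.1)) - δ₂)
    (h : ∀ k, r₁ + r₂ < mutualInfo (W.joint pU q₁ q₂) (fun ω => (ω.2.1, ω.2.2.1))
      (fun ω => ω.2.2.2 k) - δ) :
    Tendsto (fun n : ℕ => randomCodingBound (Fin (numMessages n r₁)) (Fin (numMessages n r₂))
      (V := fun k => Fin n → Y k) (W.block n) (fun k z j => z j k) (piLaw fun _ : Fin n => pU)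
      (fun u => piLaw fun j => q₁ (u j)) (fun u => piLaw fun j => q₂ (u j))
      (2 ^ ((n : ℝ) * (condMutualInfo (W.joint pU q₁ q₂) (fun ω => ω.2.1) (fun ω => ω.2.2.2)
        (fun ω => (ω.2.2.1, ω.1)) - δ₁)))
      (2 ^ ((n : ℝ) * (condMutualInfo (W.joint pU q₁ q₂) (fun ω => ω.2.2.1) (fun ω => ω.2.2.2)
        (fun ω => (ω.2.1, ω.1)) - δ₂)))
      (fun k => 2 ^ ((n : ℝ) * (mutualInfo (W.joint pU q₁ q₂) (fun ω => (ω.2.1, ω.2.2.1))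
        (fun ω => ω.2.2.2 k) - δ)))) atTop (𝓝 0) := by
  have := (((W.tendsto_density₂ hU hq₁ hq₂ hδ₂).add (tendsto_numMessages h₂)).add
    ((W.tendsto_density₁ hU hq₁ hq₂ hδ₁).add (tendsto_numMessages h₁))).add
    (tendsto_finsetSum Finset.univ fun k _ => (W.tendsto_density_receiver hU hq₁ hq₂ hδ k).add
      (tendsto_numMessages_mul hr₁ hr₂ (h k)))
  simp only [add_zero, Finset.sum_const_zero] at this
  simpa only [randomCodingBound, Fintype.card_prod, Fintype.card_fin, Nat.cast_mul] using this

/-- Rates strictly below the bounds are achieved with a number of blocks that is fixed and so large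
that the loss of the last block does not matter. -/
theorem Channel.achievable_smul (hU : pU ∈ stdSimplex ℝ U) (hq₁ : ∀ u, q₁ u ∈ stdSimplex ℝ X₁)
    (hq₂ : ∀ u, q₂ u ∈ stdSimplex ℝ X₂) {R₁ R₂ : ℝ} (hR₁ : 0 ≤ R₁) (hR₂ : 0 ≤ R₂)
    (hR : 0 < R₁ + R₂)
    (h₁ : R₁ ≤ condMutualInfo (W.joint pU q₁ q₂) (fun ω => ω.2.1) (fun ω => ω.2.2.2)
      (fun ω => (ω.2.2.1, ω.1)))
    (h₂ : R₂ ≤ condMutualInfo (W.joint pU q₁ q₂) (fun ω => ω.2.2.1) (fun ω => ω.2.2.2)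
      (fun ω => (ω.2.1, ω.1)))
    (h₁₂ : ∀ k, R₁ + R₂ ≤ mutualInfo (W.joint pU q₁ q₂) (fun ω => (ω.2.1, ω.2.2.1))
      (fun ω => ω.2.2.2 k)) {η : ℝ} (hη : 0 < η) (hη' : η < 1) :
    W.Achievable ((1 - η) * R₁, (1 - η) * R₂) := by
  obtain ⟨u₀⟩ := nonempty_of_mem_stdSimplex hU
  have : Nonempty X₁ := nonempty_of_mem_stdSimplex (hq₁ u₀)
  have : Nonempty X₂ := nonempty_of_mem_stdSimplex (hq₂ u₀)
  obtain ⟨x₁⟩ := ‹Nonempty X₁›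
  obtain ⟨x₂⟩ := ‹Nonempty X₂›
  obtain ⟨z₀⟩ := nonempty_of_mem_stdSimplex (W.prob_mem x₁ x₂)
  -- the rate of each block lies halfway between the target and the bound
  have hδ {R I : ℝ} (hR : 0 ≤ R) (hI : R ≤ I) :
      ∃ δ > 0, (1 - η / 2) * R = 0 ∨ (1 - η / 2) * R < I - δ := by
    rcases hR.eq_or_lt with rfl | hR
    · exact ⟨1, one_pos, .inl (mul_zero _)⟩
    · have := mul_pos hη hR
      exact ⟨η * R / 4, by positivity, .inr (by nlinarith)⟩
  obtain ⟨δ₁, hδ₁, hlt₁⟩ := hδ hR₁ h₁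
  obtain ⟨δ₂, hδ₂, hlt₂⟩ := hδ hR₂ h₂
  have hηR := mul_pos hη hR
  have hr₁ : 0 ≤ (1 - η / 2) * R₁ := mul_nonneg (by linarith) hR₁
  have hr₂ : 0 ≤ (1 - η / 2) * R₂ := mul_nonneg (by linarith) hR₂
  have hbound := W.tendsto_randomCodingBound hU hq₁ hq₂ hr₁ hr₂ hδ₁ hδ₂
    (δ := η * (R₁ + R₂) / 4) (by positivity) hlt₁ hlt₂ fun k => by
      have := h₁₂ k
      nlinarith
  obtain ⟨T, hT⟩ := exists_nat_gt ((1 - η) / (η / 2))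
  rw [div_lt_iff₀ (by positivity)] at hT
  -- block length `N` leaves room for `T + 1` blocks of length `N / (T + 1)`
  have hdiv : Tendsto (fun N : ℕ => N / (T + 1)) atTop atTop :=
    Nat.tendsto_div_const_atTop (Nat.succ_ne_zero T)
  have hε := (hbound.comp hdiv).const_mul ((T : ℝ) + 1)
  rw [mul_zero] at hε
  refine W.achievable_of_eventually (mul_nonneg (by linarith) hR₁)
    (mul_nonneg (by linarith) hR₂) hε ?_
  -- by the choice of `T`, the messages of `T` blocks suffice for the target rates
  have hκ : 0 < T * (1 - η / 2) - (T + 1) * (1 - η) := by linarith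
  have hlarge := (tendsto_natCast_atTop_atTop (R := ℝ)).comp hdiv |>.eventually_ge_atTop
    ((T + 1) * (1 - η) / (T * (1 - η / 2) - (T + 1) * (1 - η)))
  filter_upwards [hlarge, hdiv.eventually_gt_atTop 0] with N hN hn
  set n := N / (T + 1) with hn_def
  simp only [Function.comp_apply] at hN ⊢
  rw [← hn_def] at hN ⊢
  rw [div_le_iff₀ hκ] at hN
  have hNn : (N : ℝ) ≤ (T + 1) * (n + 1) := by
    exact_mod_cast (Nat.lt_mul_div_succ N (Nat.succ_pos T)).le
  have hrate : (N : ℝ) * (1 - η) ≤ T * (n * (1 - η / 2)) := by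
    have := mul_le_mul_of_nonneg_right hNn (sub_nonneg.2 hη'.le)
    linarith
  have hsplit {R : ℝ} (hR : 0 ≤ R) :
      numMessages N ((1 - η) * R) ≤ numMessages n ((1 - η / 2) * R) ^ T := by
    refine numMessages_le_pow ?_
    have := mul_le_mul_of_nonneg_right hrate hR
    linarith
  obtain ⟨φ₁, hφ₁, hd₁⟩ := exists_split (hsplit hR₁)
  obtain ⟨φ₂, hφ₂, hd₂⟩ := exists_split (hsplit hR₂)
  have hU' : (piLaw fun _ : Fin n => pU) ∈ stdSimplex ℝ (Fin n → U) := piLaw_mem fun _ => hU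
  have hq₁' (u : Fin n → U) : (piLaw fun j => q₁ (u j)) ∈ stdSimplex ℝ (Fin n → X₁) :=
    piLaw_mem fun j => hq₁ (u j)
  have hq₂' (u : Fin n → U) : (piLaw fun j => q₂ (u j)) ∈ stdSimplex ℝ (Fin n → X₂) :=
    piLaw_mem fun j => hq₂ (u j)
  exact exists_errorProb_le W hn (Nat.mul_div_le N (T + 1))
    (codebookLaw_mem hU' hq₁' hq₂') _ (0, 0) x₁ x₂ z₀ hφ₁ hφ₂ hd₁ hd₂
    fun p w => expect_codebookLaw_error_le (W := W.block n)
      (fun a b => piLaw_mem fun j => W.prob_mem _ _) _ hU' hq₁' hq₂' (by positivity)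
      (by positivity) (fun k => by positivity) p w

end Achievability

end FeedbackMulticast

end

theorem lemma1 {X₁ X₂ : Type*} [Fintype X₁] [Fintype X₂] {K : ℕ} {Y : Fin K → Type*}
    [∀ k, Fintype (Y k)] (W : FeedbackMulticast.Channel X₁ X₂ Y)
    {U : Type*} [Fintype U] (pU : U → ℝ) (q₁ : U → X₁ → ℝ) (q₂ : U → X₂ → ℝ)
    (hU : pU ∈ stdSimplex ℝ U) (hq₁ : ∀ u, q₁ u ∈ stdSimplex ℝ X₁)
    (hq₂ : ∀ u, q₂ u ∈ stdSimplex ℝ X₂)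
    (R₁ R₂ : ℝ) (hR₁ : 0 ≤ R₁) (hR₂ : 0 ≤ R₂)
    -- a sample point is `ω = (u, x₁, x₂, (y₁, …, y_K))`
    (h₁ : R₁ ≤ FeedbackMulticast.condMutualInfo (W.joint pU q₁ q₂)
      (fun ω => ω.2.1) (fun ω => ω.2.2.2) (fun ω => (ω.2.2.1, ω.1)))
    (h₂ : R₂ ≤ FeedbackMulticast.condMutualInfo (W.joint pU q₁ q₂)
      (fun ω => ω.2.2.1) (fun ω => ω.2.2.2) (fun ω => (ω.2.1, ω.1)))
    (h₁₂ : ∀ k, R₁ + R₂ ≤ FeedbackMulticast.mutualInfo (W.joint pU q₁ q₂)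
      (fun ω => (ω.2.1, ω.2.2.1)) (fun ω => ω.2.2.2 k)) :
    (R₁, R₂) ∈ W.capacityRegion := by
  rcases (add_nonneg hR₁ hR₂).eq_or_lt with h | h
  · obtain ⟨u⟩ := FeedbackMulticast.nonempty_of_mem_stdSimplex hU
    have := FeedbackMulticast.nonempty_of_mem_stdSimplex (hq₁ u)
    have := FeedbackMulticast.nonempty_of_mem_stdSimplex (hq₂ u)
    obtain rfl : R₁ = 0 := by linarith
    obtain rfl : R₂ = 0 := by linarith
    exact subset_closure W.achievable_zero
  · have hlim : Tendsto (fun η : ℝ => ((1 - η) * R₁, (1 - η) * R₂)) (𝓝[>] 0) (𝓝 (R₁, R₂)) := by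
      have : Continuous fun η : ℝ => ((1 - η) * R₁, (1 - η) * R₂) := by fun_prop
      simpa using (this.tendsto 0).mono_left nhdsWithin_le_nhds
    refine mem_closure_of_tendsto hlim ?_
    filter_upwards [Ioo_mem_nhdsGT (zero_lt_one' ℝ)] with η hη
    exact W.achievable_smul hU hq₁ hq₂ hR₁ hR₂ h h₁ h₂ h₁₂ hη.1 hη.2
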